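/- Let $\mathcal F$ be the Fock space of entire functions $F:\mathbb C\to\mathbb C$ with $\|F\|^2=\int_{\mathbb C}|F(z)|^2e^{-\pi|z|^2}\,dA(z)<\infty$, where $dA$ is Lebesgue measure, regarded as a closed subspace of $L^2(\mathbb C,e^{-\pi|z|^2}dA)$, and let $P$ be the orthogonal projection of $L^2(\mathbb C,e^{-\pi|z|^2}dA)$ onto $\mathcal F$. For a measurable set $\Omega\subset\mathbb C$ of finite measure $|\Omega|>0$ let $T_\Omega=P\chi_\Omega:\mathcal F\to\mathcal F$ be the Toeplitz operator with symbol the characteristic function of $\Omega$, and let $\lambda_1(\Omega)\ge\lambda_2(\Omega)\ge\cdots>0$ be its eigenvalues, in decreasing order and repeated according to multiplicity. A measurable set $\Omega\subset\mathbb C$ is called circularly symmetric if $\Omega=\{z\in\mathbb C: |z-w|\in E\}$ for some $w\in\mathbb C$ and some measurable $E\subset[0,\infty)$. Let $\Omega\subset\mathbb C$ be a circularly symmetric set of finite area $|\Omega|>0$, and let $\Omega^*$ be a ball (open disc) with $|\Omega^*|=|\Omega|$. Then $\lambda_k(\Omega),\lambda_k(\Omega^*)\in(0,1)$ for every $k\ge1$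 and, for every $n\ge1$ and every convex increasing (i.e. non-decreasing) function $\Phi:(0,1)\to\mathbb R$, $$\sum_{k=1}^n\Phi(\lambda_k(\Omega))\le\sum_{k=1}^n\Phi(\lambda_k(\Omega^*)).$$ -/

import Mathlib

open MeasureTheory Set Filter
open scoped ENNReal Topology

namespace FockToeplitz

/-- The Gaussian weighted Lebesgue measure `e^{-π |z|²} dA(z)` on the complex plane. -/
noncomputable def gaussMeasure : Measure ℂ :=
  (volume : Measure ℂ).withDensity fun z => ENNReal.ofReal (Real.exp (-Real.pi * ‖z‖ ^ 2))

/-- The Hilbert space `L²(ℂ, e^{-π |z|²} dA(z))`. -/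
abbrev L2Gauss : Type := Lp ℂ 2 gaussMeasure

/-- The Fock space: the elements of `L²(ℂ, e^{-π |z|²} dA(z))` that are represented by an entire
function, with the inner product and the norm of the ambient `L²` space. -/
noncomputable def fockSpace : Submodule ℂ L2Gauss where
  carrier := {f | ∃ F : ℂ → ℂ, Differentiable ℂ F ∧ f =ᵐ[gaussMeasure] F}
  add_mem' := by
    rintro f g ⟨F, hF, hfF⟩ ⟨G, hG, hgG⟩
    exact ⟨F + G, hF.add hG, (Lp.coeFn_add f g).trans (hfF.add hgG)⟩
  zero_mem' := ⟨0, differentiable_const 0, Lp.coeFn_zero _ _ _⟩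
  smul_mem' := by
    rintro c f ⟨F, hF, hfF⟩
    exact ⟨c • F, hF.const_smul c, (Lp.coeFn_smul c f).trans (hfF.const_smul c)⟩

/-! ### The Fock space is closed, so that the orthogonal projection onto it exists -/

/-- Mean value inequality on a circle. -/
theorem enorm_le_lintegral_circle {H : ℂ → ℂ} (hH : Differentiable ℂ H) (z : ℂ) (r : ℝ) :
    ‖H z‖ₑ ≤ ∫⁻ θ in Ioo (-Real.pi) Real.pi, ‖H (circleMap z r θ)‖ₑ := by
  have h1 : Real.circleAverage H z r = H z :=
    DiffContOnCl.circleAverage hH.diffContOnCl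
  rw [Real.circleAverage_eq_integral_add (-Real.pi),
    intervalIntegral.integral_comp_add_right (fun θ ↦ H (circleMap z r θ))] at h1
  have e1 : (0 : ℝ) + -Real.pi = -Real.pi := by ring
  have e2 : 2 * Real.pi + -Real.pi = Real.pi := by ring
  have hpi := Real.pi_gt_three
  rw [e1, e2, intervalIntegral.integral_of_le (by linarith),
    integral_Ioc_eq_integral_Ioo] at h1
  rw [← h1, enorm_smul]
  calc ‖(2 * Real.pi)⁻¹‖ₑ * ‖∫ θ in Ioo (-Real.pi) Real.pi, H (circleMap z r θ)‖ₑ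
      ≤ 1 * ∫⁻ θ in Ioo (-Real.pi) Real.pi, ‖H (circleMap z r θ)‖ₑ := by
        gcongr
        · rw [Real.enorm_eq_ofReal (by positivity), ENNReal.ofReal_le_one]
          exact inv_le_one_of_one_le₀ (by linarith)
        · exact enorm_integral_le_lintegral_enorm _
    _ = _ := one_mul _

/-- Mean value inequality on a disc. -/
theorem enorm_le_lintegral_ball {H : ℂ → ℂ} (hH : Differentiable ℂ H) (z : ℂ) :
    ‖H z‖ₑ ≤ 4 * ∫⁻ w in Metric.ball z 1, ‖H w‖ₑ := by
  have hmeas : Measurable fun w => ‖H w‖ₑ := hH.continuous.measurable.enorm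
  have hind : Measurable ((Metric.ball z 1).indicator fun w => ‖H w‖ₑ) :=
    hmeas.indicator measurableSet_ball
  have key : ENNReal.ofReal (1 / 4) * ‖H z‖ₑ ≤ ∫⁻ w in Metric.ball z 1, ‖H w‖ₑ := by
    rw [← lintegral_indicator measurableSet_ball,
      ← lintegral_add_left_eq_self _ z, ← Complex.lintegral_comp_polarCoord_symm,
      polarCoord_target, Measure.volume_eq_prod, ← Measure.prod_restrict]
    rw [lintegral_prod _ (by
      refine Measurable.aemeasurable ?_
      simp only [Complex.polarCoord_symm_apply, smul_eq_mul]
      refine (by fun_prop : Measurable fun p : ℝ × ℝ => ENNReal.ofReal p.1).mul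
        (hind.comp ?_)
      fun_prop)]
    calc ENNReal.ofReal (1 / 4) * ‖H z‖ₑ
        = ∫⁻ r in Ioo (1 / 2 : ℝ) 1, ENNReal.ofReal (1 / 2) * ‖H z‖ₑ := by
          rw [setLIntegral_const, Real.volume_Ioo, mul_right_comm,
            ← ENNReal.ofReal_mul (by norm_num)]
          norm_num
      _ ≤ ∫⁻ r in Ioo (1 / 2 : ℝ) 1, ∫⁻ θ in Ioo (-Real.pi) Real.pi,
            ENNReal.ofReal r • (Metric.ball z 1).indicator (fun w => ‖H w‖ₑ)
              (z + Complex.polarCoord.symm (r, θ)) := by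
          refine setLIntegral_mono' measurableSet_Ioo fun r hr => ?_
          have hc : ∀ θ, z + Complex.polarCoord.symm (r, θ) = circleMap z r θ := by
            intro θ
            simp [circleMap, Complex.exp_mul_I]
          have hb : ∀ θ, circleMap z r θ ∈ Metric.ball z 1 := by
            intro θ
            have : (0 : ℝ) < r := by linarith [hr.1]
            simp [circleMap, abs_of_pos this, hr.2]
          simp only [hc, indicator_of_mem (hb _), smul_eq_mul]
          rw [lintegral_const_mul' _ _ ENNReal.ofReal_ne_top]
          gcongr
          · exact hr.1.le
          · exact enorm_le_lintegral_circle hH z r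
      _ ≤ _ := lintegral_mono_set fun r hr => by
          have := hr.1
          simp only [mem_Ioi]
          linarith
  calc ‖H z‖ₑ = 4 * (ENNReal.ofReal (1 / 4) * ‖H z‖ₑ) := by
        rw [← mul_assoc, show (4 : ℝ≥0∞) = ENNReal.ofReal 4 by norm_num,
          ← ENNReal.ofReal_mul (by norm_num)]
        norm_num
    _ ≤ _ := by gcongr

/-- Point evaluations are locally uniformly bounded on the Fock space. -/
theorem norm_le_of_entire {F : ℂ → ℂ} (hF : Differentiable ℂ F) {f : L2Gauss}
    (hf : f =ᵐ[gaussMeasure] F) {R : ℝ} (hR : 0 ≤ R) {z : ℂ} (hz : ‖z‖ ≤ R) :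
    ‖F z‖ ≤ 2 * Real.exp (Real.pi * (R + 1) ^ 2) * ‖f‖ := by
  set K : ℝ := Real.exp (Real.pi * (R + 1) ^ 2) with hK
  have hK1 : 1 ≤ K := Real.one_le_exp (by positivity)
  have hm : Measurable fun w => ‖F w‖ₑ ^ 2 := hF.continuous.measurable.enorm.pow_const 2
  have h1 := enorm_le_lintegral_ball (hF.pow 2) z
  have h2 : ∫⁻ w in Metric.ball z 1, ‖F w ^ 2‖ₑ ≤
      ENNReal.ofReal K * ∫⁻ w, ‖F w‖ₑ ^ 2 ∂gaussMeasure := by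
    rw [gaussMeasure, lintegral_withDensity_eq_lintegral_mul _ (by fun_prop) hm,
      ← lintegral_const_mul' _ _ ENNReal.ofReal_ne_top]
    refine le_trans ?_ (setLIntegral_le_lintegral (Metric.ball z 1) _)
    refine setLIntegral_mono' measurableSet_ball fun w hw => ?_
    have hw' : ‖w‖ ≤ R + 1 := by
      have h3 : ‖w - z‖ < 1 := by simpa [dist_eq_norm] using hw
      have h4 := norm_le_norm_add_norm_sub' w z
      linarith
    have h5 : (1 : ℝ≥0∞) ≤ ENNReal.ofReal K *
        ENNReal.ofReal (Real.exp (-Real.pi * ‖w‖ ^ 2)) := by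
      rw [← ENNReal.ofReal_mul (by positivity), hK, ← Real.exp_add, ENNReal.one_le_ofReal]
      refine Real.one_le_exp ?_
      have : ‖w‖ ^ 2 ≤ (R + 1) ^ 2 := by gcongr
      nlinarith [Real.pi_pos]
    simp only [Pi.mul_apply, enorm_pow]
    rw [← mul_assoc]
    exact le_mul_of_one_le_left' h5
  have h3 : ∫⁻ w, ‖F w‖ₑ ^ 2 ∂gaussMeasure = ENNReal.ofReal (‖f‖ ^ 2) := by
    have e : ∫⁻ w, ‖F w‖ₑ ^ 2 ∂gaussMeasure = ∫⁻ w, ‖f w‖ₑ ^ 2 ∂gaussMeasure :=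
      lintegral_congr_ae (hf.mono fun w hw => by simp only [hw])
    have e2 := eLpNorm_nnreal_pow_eq_lintegral (f := (f : ℂ → ℂ)) (μ := gaussMeasure)
      (p := 2) (by norm_num)
    rw [e, ENNReal.ofReal_pow (norm_nonneg _), Lp.norm_def,
      ENNReal.ofReal_toReal (Lp.eLpNorm_ne_top f)]
    have e3 : ∫⁻ w, ‖f w‖ₑ ^ 2 ∂gaussMeasure = eLpNorm f 2 gaussMeasure ^ (2 : ℝ) := by
      simpa using e2.symm
    rw [e3]
    norm_num
  have h4 : ENNReal.ofReal (‖F z‖ ^ 2) ≤ ENNReal.ofReal (4 * (K * ‖f‖ ^ 2)) := by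
    rw [ENNReal.ofReal_mul (by norm_num), ENNReal.ofReal_mul (by positivity), ← h3]
    calc ENNReal.ofReal (‖F z‖ ^ 2) = ‖(F ^ 2) z‖ₑ := by
          rw [Pi.pow_apply, ← ofReal_norm, norm_pow]
      _ ≤ _ := h1
      _ ≤ _ := by
        rw [show ENNReal.ofReal 4 = 4 by norm_num]
        gcongr
        exact h2
  rw [ENNReal.ofReal_le_ofReal_iff (by positivity)] at h4
  refine abs_le_of_sq_le_sq' ?_ (by positivity) |>.2
  have : K * ‖f‖ ^ 2 ≤ K ^ 2 * ‖f‖ ^ 2 := by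
    gcongr
    nlinarith
  nlinarith

theorem isClosed_fockSpace : IsClosed (fockSpace : Set L2Gauss) := by
  refine isSeqClosed_iff_isClosed.mp fun f g hf hg => ?_
  choose F hF hfF using hf
  have hC : CauchySeq f := hg.cauchySeq
  have hbound : ∀ R : ℝ, 0 ≤ R → ∀ m n z, ‖z‖ ≤ R →
      dist (F m z) (F n z) ≤ 2 * Real.exp (Real.pi * (R + 1) ^ 2) * dist (f m) (f n) := by
    intro R hR m n z hz
    rw [dist_eq_norm, dist_eq_norm]
    exact norm_le_of_entire (F := fun z => F m z - F n z) ((hF m).sub (hF n))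
      ((Lp.coeFn_sub _ _).trans ((hfF m).sub (hfF n))) hR hz
  have hUC : ∀ R : ℝ, 0 ≤ R → UniformCauchySeqOn F atTop (Metric.closedBall 0 R) := by
    intro R hR
    rw [Metric.uniformCauchySeqOn_iff]
    intro ε hε
    have hKpos : 0 < 2 * Real.exp (Real.pi * (R + 1) ^ 2) := by positivity
    obtain ⟨N, hN⟩ := Metric.cauchySeq_iff.mp hC (ε / (2 * Real.exp (Real.pi * (R + 1) ^ 2)))
      (by positivity)
    refine ⟨N, fun m hm n hn z hz => ?_⟩
    refine (hbound R hR m n z (by simpa using hz)).trans_lt ?_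
    have := hN m hm n hn
    rwa [lt_div_iff₀' hKpos] at this
  have hpt : ∀ z, ∃ w, Tendsto (fun n => F n z) atTop (𝓝 w) := fun z =>
    cauchySeq_tendsto_of_complete
      ((hUC ‖z‖ (norm_nonneg z)).cauchySeq (by simp))
  choose G hG using hpt
  have hloc : TendstoLocallyUniformlyOn F G atTop univ := by
    rw [tendstoLocallyUniformlyOn_iff_forall_isCompact isOpen_univ]
    intro K _ hK
    obtain ⟨R, hR⟩ := hK.isBounded.subset_closedBall 0
    have hR' : K ⊆ Metric.closedBall 0 (max R 0) :=
      hR.trans (Metric.closedBall_subset_closedBall (le_max_left _ _))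
    exact ((hUC _ (le_max_right _ _)).tendstoUniformlyOn_of_tendsto
      fun z _ => hG z).mono hR'
  have hGd : Differentiable ℂ G := by
    rw [← differentiableOn_univ]
    exact hloc.differentiableOn (Eventually.of_forall fun n => (hF n).differentiableOn)
      isOpen_univ
  refine ⟨G, hGd, ?_⟩
  obtain ⟨φ, hφ, hφt⟩ := (tendstoInMeasure_of_tendsto_Lp hg).exists_seq_tendsto_ae
  have hall : ∀ᵐ z ∂gaussMeasure, ∀ n, f n z = F n z := ae_all_iff.mpr hfF
  filter_upwards [hφt, hall] with z h1 h2
  refine tendsto_nhds_unique h1 ?_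
  simp only [h2]
  exact (hG z).comp hφ.tendsto_atTop

instance : CompleteSpace fockSpace := isClosed_fockSpace.completeSpace_coe

/-! ### Toeplitz operators and their eigenvalues -/

theorem memLp_indicator {Ω : Set ℂ} (hΩ : NullMeasurableSet Ω volume) (f : L2Gauss) :
    MemLp (Ω.indicator f) 2 gaussMeasure :=
  ⟨(Lp.aestronglyMeasurable f).indicator₀ (hΩ.mono_ac (withDensity_absolutelyContinuous _ _)),
    (eLpNorm_indicator_le _).trans_lt (Lp.memLp f).2⟩

/-- Multiplication by the characteristic function of a (Lebesgue) measurable set `Ω`, as a bounded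
operator on `L²(ℂ, e^{-π |z|²} dA(z))`. -/
noncomputable def mulIndicator {Ω : Set ℂ} (hΩ : NullMeasurableSet Ω volume) :
    L2Gauss →L[ℂ] L2Gauss :=
  LinearMap.mkContinuous
    { toFun := fun f => (memLp_indicator hΩ f).toLp (Ω.indicator f)
      map_add' := fun f g => by
        rw [← MemLp.toLp_add]
        refine MemLp.toLp_congr _ _ ?_
        filter_upwards [Lp.coeFn_add f g] with z hz
        rw [← indicator_add']
        by_cases h : z ∈ Ω
        · rw [indicator_of_mem h, indicator_of_mem h, hz]
        · rw [indicator_of_notMem h, indicator_of_notMem h]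
      map_smul' := fun c f => by
        rw [RingHom.id_apply, ← MemLp.toLp_const_smul]
        refine MemLp.toLp_congr _ _ ?_
        filter_upwards [Lp.coeFn_smul c f] with z hz
        rw [Pi.smul_apply]
        by_cases h : z ∈ Ω
        · rw [indicator_of_mem h, indicator_of_mem h, hz, Pi.smul_apply]
        · rw [indicator_of_notMem h, indicator_of_notMem h, smul_zero] }
    1
    (fun f => by
      rw [one_mul]
      refine Lp.norm_le_norm_of_ae_le ?_
      filter_upwards [(memLp_indicator hΩ f).coeFn_toLp] with z hz
      simp only [LinearMap.coe_mk, AddHom.coe_mk]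
      rw [hz]
      exact norm_indicator_le_norm_self _ _)

/-- The Toeplitz operator `T_Ω = P χ_Ω` on the Fock space, where `P` is the orthogonal projection
of `L²(ℂ, e^{-π |z|²} dA(z))` onto the Fock space. -/
noncomputable def toeplitz {Ω : Set ℂ} (hΩ : NullMeasurableSet Ω volume) :
    fockSpace →L[ℂ] fockSpace :=
  fockSpace.orthogonalProjectionOnto ∘L mulIndicator hΩ ∘L fockSpace.subtypeL

/-- The `k`-th largest positive eigenvalue (`k = 1, 2, …`), counted with multiplicity, of an
operator `T` whose positive eigenvalues have finite multiplicity and can only accumulate at `0`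
(for instance a compact self-adjoint one): the largest `t > 0` such that the eigenspaces of `T`
for the real eigenvalues `s ≥ t` together have dimension at least `k`. -/
noncomputable def nthEigenvalue {H : Type*} [AddCommGroup H] [Module ℂ H] (T : H →ₗ[ℂ] H)
    (k : ℕ) : ℝ :=
  sSup {t : ℝ | 0 < t ∧
    (k : Cardinal) ≤ Module.rank ℂ ↥(⨆ s ∈ Ici t, Module.End.eigenspace T ((s : ℝ) : ℂ))}

/-- `λ_k(Ω)`: the `k`-th eigenvalue (`k = 1, 2, …`) of the Toeplitz operator `T_Ω`, in decreasing
order and with multiplicity. -/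
noncomputable def eigenvalue {Ω : Set ℂ} (hΩ : NullMeasurableSet Ω volume) (k : ℕ) : ℝ :=
  nthEigenvalue (toeplitz hΩ).toLinearMap k

/-- `Ω` is, up to a translation, of the form `{z | |z| ∈ E}` with `E ⊆ [0, ∞)` measurable. -/
def IsCircularlySymmetric (Ω : Set ℂ) : Prop :=
  ∃ (w : ℂ) (E : Set ℝ), E ⊆ Ici 0 ∧ NullMeasurableSet E volume ∧ Ω = {z | ‖z - w‖ ∈ E}

end FockToeplitz

/-! Write `Ω`, up to a null set, as the points `z` with `π‖z - w‖² ∈ S`, where `S ⊆ (0, ∞)`. The map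
`z ↦ π‖z‖²` pushes area forward to Lebesgue measure on `(0, ∞)`, so `|S| = |Ω|`. By rotation
invariance the monomials, translated to the centre `w`, diagonalize `T_Ω`, with eigenvalues the
masses `μ_k(S) = ∫_S t^k e^{-t} / k! dt`. For the disc, `S = (0, L)` with `L = |Ω|`; there the
masses decrease in `k`, and the first `m` of them add up to `poissonCdfPrimitive m L`.

Everything thus rests on a rearrangement inequality, `sum_poissonMass_le`: for every set `J` of `m`
indices, `∑_{j ∈ J} μ_j(S) ≤ poissonCdfPrimitive m |S|`. View `poissonWeight k t` as the probability
that a rate one Poisson process is in state `k` at time `t`. The left side is the expected time in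
`S` during which the state lies in `J`. With budget `|S|`, the best choice is to spend it at once
and to have the first `m` states as `J`. The proof in `integral_mul_sum_poissonWeight_le` is a
dynamic programming argument: what has been collected plus the expected best future gain never
increases.

Choosing for `J` the indices of the `m` largest masses gives weak majorization of the eigenvalues of
`T_Ω` by those of the disc. Karamata's inequality, `sum_le_sum_of_weakly_majorized`, passes to
convex nondecreasing `Φ`. -/

namespace FockToeplitz

/-! ### Poisson weights and their distribution functions -/

/-- The Poisson weights `t ^ k e^{-t} / k!`. -/
noncomputable def poissonWeight (k : ℕ) (t : ℝ) : ℝ := t ^ k * Real.exp (-t) / k.factorial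

/-- The Poisson distribution function `∑_{j < m} t ^ j e^{-t} / j!`. -/
noncomputable def poissonCdf (m : ℕ) (t : ℝ) : ℝ := ∑ j ∈ Finset.range m, poissonWeight j t

/-- The primitive of `poissonCdf m` that vanishes at `0`. -/
noncomputable def poissonCdfPrimitive (m : ℕ) (t : ℝ) : ℝ :=
  ∑ j ∈ Finset.range m, (1 - poissonCdf (j + 1) t)

theorem poissonWeight_nonneg (k : ℕ) {t : ℝ} (ht : 0 ≤ t) : 0 ≤ poissonWeight k t := by
  unfold poissonWeight; positivity

theorem continuous_poissonWeight (k : ℕ) : Continuous (poissonWeight k) := by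
  unfold poissonWeight; fun_prop

theorem hasDerivAt_poissonWeight_zero (t : ℝ) :
    HasDerivAt (poissonWeight 0) (-poissonWeight 0 t) t := by
  have h := (Real.hasDerivAt_exp (-t)).comp t (hasDerivAt_neg t)
  have e : poissonWeight 0 = Real.exp ∘ Neg.neg := by
    ext s; simp [poissonWeight]
  rw [e]
  exact h.congr_deriv (by simp)

theorem hasDerivAt_poissonWeight_succ (k : ℕ) (t : ℝ) :
    HasDerivAt (poissonWeight (k + 1)) (poissonWeight k t - poissonWeight (k + 1) t) t := by
  have h := (((hasDerivAt_pow (k + 1) t).mul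
    ((Real.hasDerivAt_exp (-t)).comp t (hasDerivAt_neg t))).div_const ((k + 1).factorial : ℝ))
  refine h.congr_deriv ?_
  have hk : (k.factorial : ℝ) ≠ 0 := by positivity
  have hk' : (k : ℝ) + 1 ≠ 0 := by positivity
  simp only [poissonWeight, Nat.factorial_succ, Nat.cast_mul, Nat.cast_add, Nat.cast_one,
    Function.comp, Nat.add_sub_cancel]
  field_simp
  ring

theorem hasDerivAt_poissonCdf_succ (m : ℕ) (t : ℝ) :
    HasDerivAt (poissonCdf (m + 1)) (-poissonWeight m t) t := by
  induction m with
  | zero =>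
    have e : poissonCdf (0 + 1) = poissonWeight 0 := by
      ext s; simp [poissonCdf]
    rw [e]
    exact hasDerivAt_poissonWeight_zero t
  | succ m ih =>
    have e : poissonCdf (m + 1 + 1) = poissonCdf (m + 1) + poissonWeight (m + 1) := by
      ext s; simp [poissonCdf, Finset.sum_range_succ]
    rw [e]
    refine (ih.add (hasDerivAt_poissonWeight_succ m t)).congr_deriv ?_
    ring

theorem hasDerivAt_poissonCdfPrimitive (m : ℕ) (t : ℝ) :
    HasDerivAt (poissonCdfPrimitive m) (poissonCdf m t) t := by
  unfold poissonCdfPrimitive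
  have h : ∀ j ∈ Finset.range m, HasDerivAt (fun t => 1 - poissonCdf (j + 1) t)
      (poissonWeight j t) t := fun j _ => by
    simpa using (hasDerivAt_poissonCdf_succ j t).const_sub 1
  exact HasDerivAt.fun_sum h

theorem continuous_poissonCdfPrimitive (m : ℕ) : Continuous (poissonCdfPrimitive m) :=
  continuous_iff_continuousAt.2 fun t => (hasDerivAt_poissonCdfPrimitive m t).continuousAt

theorem sum_poissonWeight_le_one (J : Finset ℕ) {t : ℝ} (ht : 0 ≤ t) :
    ∑ j ∈ J, poissonWeight j t ≤ 1 := by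
  have h1 : ∀ m, poissonCdf m t ≤ 1 := by
    intro m
    have h2 := Real.sum_le_exp_of_nonneg ht m
    have h3 : poissonCdf m t = (∑ i ∈ Finset.range m, t ^ i / i.factorial) * Real.exp (-t) := by
      rw [poissonCdf, Finset.sum_mul]
      refine Finset.sum_congr rfl fun i _ => ?_
      rw [poissonWeight]; ring
    rw [h3]
    calc _ ≤ Real.exp t * Real.exp (-t) := by gcongr
      _ = 1 := by rw [← Real.exp_add]; simp
  refine le_trans (Finset.sum_le_sum_of_subset_of_nonneg
    (t := Finset.range (J.sup id + 1)) (fun j hj => ?_)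
    fun i _ _ => poissonWeight_nonneg i ht) (h1 _)
  rw [Finset.mem_range, Nat.lt_succ_iff]
  exact Finset.le_sup (f := id) hj

theorem poissonCdf_nonneg (m : ℕ) {t : ℝ} (ht : 0 ≤ t) : 0 ≤ poissonCdf m t :=
  Finset.sum_nonneg fun _ _ => poissonWeight_nonneg _ ht

theorem poissonCdf_le_one (m : ℕ) {t : ℝ} (ht : 0 ≤ t) : poissonCdf m t ≤ 1 :=
  sum_poissonWeight_le_one _ ht

theorem poissonCdf_succ_zero (m : ℕ) : poissonCdf (m + 1) 0 = 1 := by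
  simp [poissonCdf, poissonWeight, Finset.sum_range_succ']

theorem poissonCdfPrimitive_nonneg (m : ℕ) {t : ℝ} (ht : 0 ≤ t) :
    0 ≤ poissonCdfPrimitive m t :=
  Finset.sum_nonneg fun _ _ => sub_nonneg.2 (poissonCdf_le_one _ ht)

theorem monotoneOn_poissonCdfPrimitive (m : ℕ) :
    MonotoneOn (poissonCdfPrimitive m) (Ici 0) := by
  refine monotoneOn_of_deriv_nonneg (convex_Ici 0) (continuous_poissonCdfPrimitive m).continuousOn
    (fun t _ => (hasDerivAt_poissonCdfPrimitive m t).differentiableAt.differentiableWithinAt)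
    fun t ht => ?_
  rw [(hasDerivAt_poissonCdfPrimitive m t).deriv]
  rw [interior_Ici] at ht
  exact poissonCdf_nonneg m (le_of_lt ht)

/-! ### The rearrangement inequality for sums of Poisson masses -/

/-- Summation by parts against the derivatives of the Poisson weights. -/
theorem exists_hasDerivAt_poissonWeight (c : ℕ → ℝ) (K : ℕ) (t : ℝ) :
    ∃ d : ℕ → ℝ, (∀ k, HasDerivAt (poissonWeight k) (d k) t) ∧
      ∑ k ∈ Finset.range K, d k * c k =
        ∑ k ∈ Finset.range K, poissonWeight k t * (c (k + 1) - c k) +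
          (if K = 0 then 0 else - poissonWeight (K - 1) t * c K) := by
  refine ⟨fun k => match k with
    | 0 => -poissonWeight 0 t
    | k + 1 => poissonWeight k t - poissonWeight (k + 1) t, ?_, ?_⟩
  · rintro (_ | k)
    · exact hasDerivAt_poissonWeight_zero t
    · exact hasDerivAt_poissonWeight_succ k t
  · induction K with
    | zero => simp
    | succ K ih =>
      rw [Finset.sum_range_succ, ih, Finset.sum_range_succ]
      rcases K with _ | K
      · simp; ring
      · simp; ring

/-- The density `h` is a control with values in `[0, 1]` and budget `∫ h`. Taking `h` continuous
makes the value function `W` below differentiable, so that its monotonicity can be read off from the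
derivative. -/
theorem integral_mul_sum_poissonWeight_le {h : ℝ → ℝ} (hc : Continuous h)
    (h0 : ∀ t, 0 ≤ h t) (h1 : ∀ t, h t ≤ 1) {T : ℝ} (hT : 0 ≤ T) (J : Finset ℕ) :
    ∫ t in (0 : ℝ)..T, h t * ∑ j ∈ J, poissonWeight j t ≤
      poissonCdfPrimitive J.card (∫ t in (0 : ℝ)..T, h t) := by
  classical
  set K := J.sup id + 1 with hK
  have hJK : ∀ j ∈ J, j < K := fun j hj => Nat.lt_succ_iff.2 (Finset.le_sup (f := id) hj)
  -- The number of states of `J` that a process now in state `k` has not yet left.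
  set m : ℕ → ℕ := fun k => (J.filter (k ≤ ·)).card with hm
  have hm0 : m 0 = J.card := by simp [hm]
  have hmK : m K = 0 := by
    simp only [hm, Finset.card_eq_zero, Finset.filter_eq_empty_iff, not_le]
    exact fun j hj => hJK j hj
  have hmS : ∀ k, m k = m (k + 1) + if k ∈ J then 1 else 0 := by
    intro k
    have : J.filter (k ≤ ·) = J.filter (k + 1 ≤ ·) ∪ J.filter (k = ·) := by
      ext j; simp only [Finset.mem_filter, Finset.mem_union]; grind
    simp only [hm]
    rw [this, Finset.card_union_of_disjoint (by
      rw [Finset.disjoint_filter]; intro j _; omega), Finset.filter_eq]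
    split_ifs <;> simp
  set F : ℝ → ℝ := fun t => ∑ j ∈ J, poissonWeight j t with hF
  have hFc : Continuous F := by
    exact continuous_finsetSum _ fun j _ => continuous_poissonWeight j
  -- The budget remaining at time `t`.
  set l : ℝ → ℝ := fun t => ∫ s in t..T, h s with hl
  have hl' : ∀ t, HasDerivAt l (-h t) t := fun t =>
    intervalIntegral.integral_hasDerivAt_left (hc.intervalIntegrable _ _)
      hc.stronglyMeasurable.stronglyMeasurableAtFilter hc.continuousAt
  have hlnn : ∀ t, t ≤ T → 0 ≤ l t := fun t ht =>
    intervalIntegral.integral_nonneg ht fun s _ => h0 s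
  -- The gain collected up to time `t`, plus the expected value of the ideal continuation: in state
  -- `k`, the remaining budget is spent at once on `m k` consecutive states.
  set W : ℝ → ℝ := fun t => ∑ k ∈ Finset.range K, poissonWeight k t *
    poissonCdfPrimitive (m k) (l t) + ∫ s in (0 : ℝ)..t, h s * F s with hW
  have hW' : ∀ t, ∃ d, HasDerivAt W d t ∧ (0 ≤ t → t ≤ T → d ≤ 0) := by
    intro t
    obtain ⟨d, hd, hsum⟩ := exists_hasDerivAt_poissonWeight
      (fun k => poissonCdfPrimitive (m k) (l t)) K t
    have hI : HasDerivAt (fun t => ∫ s in (0 : ℝ)..t, h s * F s) (h t * F t) t :=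
      intervalIntegral.integral_hasDerivAt_right ((hc.mul hFc).intervalIntegrable _ _)
        (hc.mul hFc).stronglyMeasurable.stronglyMeasurableAtFilter (hc.mul hFc).continuousAt
    refine ⟨_, (HasDerivAt.fun_sum fun k _ => (hd k).mul
      ((hasDerivAt_poissonCdfPrimitive (m k) (l t)).comp t (hl' t))).add hI, fun ht htT => ?_⟩
    have hFt : F t = ∑ k ∈ Finset.range K, poissonWeight k t * if k ∈ J then 1 else 0 := by
      simp only [hF, mul_ite, mul_one, mul_zero, Finset.sum_ite_mem]
      refine Finset.sum_congr ?_ fun _ _ => rfl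
      ext j; simpa using hJK j
    simp only [Function.comp_apply]
    -- The boundary term of the summation by parts vanishes because `m K = 0`.
    rw [Finset.sum_add_distrib, hsum, hFt, Finset.mul_sum, hmK, if_neg (by omega)]
    have hz : poissonCdfPrimitive 0 (l t) = 0 := by simp [poissonCdfPrimitive]
    rw [hz, mul_zero, add_zero, ← Finset.sum_add_distrib, ← Finset.sum_add_distrib]
    refine Finset.sum_nonpos fun k _ => ?_
    have hp := poissonWeight_nonneg k ht
    have hQ0 := poissonCdf_nonneg (m k) (hlnn t htT)
    have hQ1 := poissonCdf_le_one (m k) (hlnn t htT)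
    have e := hmS k
    -- With `q = poissonCdf (m k) (l t)`, state `k` contributes `-p_k (1 - h)(1 - q)` to the
    -- derivative if `k ∈ J`, where `m` drops by one, and `-p_k h q` otherwise.
    by_cases hk : k ∈ J
    · rw [if_pos hk] at e ⊢
      have e2 : poissonCdfPrimitive (m (k + 1)) (l t) - poissonCdfPrimitive (m k) (l t) =
          -(1 - poissonCdf (m k) (l t)) := by
        rw [e, poissonCdfPrimitive, poissonCdfPrimitive, Finset.sum_range_succ]; ring
      rw [e2]
      have : 0 ≤ poissonWeight k t * ((1 - h t) * (1 - poissonCdf (m k) (l t))) :=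
        mul_nonneg hp (mul_nonneg (by linarith [h1 t]) (by linarith))
      linarith
    · rw [if_neg hk] at e ⊢
      rw [e]
      simp only [add_zero] at e ⊢
      have : 0 ≤ poissonWeight k t * (poissonCdf (m k) (l t) * h t) :=
        mul_nonneg hp (mul_nonneg hQ0 (h0 t))
      rw [← e]
      linarith
  have hanti : AntitoneOn W (Icc 0 T) := by
    refine antitoneOn_of_deriv_nonpos (convex_Icc 0 T)
      (fun t _ => (hW' t).choose_spec.1.continuousAt.continuousWithinAt)
      (fun t _ => (hW' t).choose_spec.1.differentiableAt.differentiableWithinAt) fun t ht => ?_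
    rw [interior_Icc] at ht
    rw [(hW' t).choose_spec.1.deriv]
    exact (hW' t).choose_spec.2 ht.1.le ht.2.le
  have hfin := hanti (left_mem_Icc.2 hT) (right_mem_Icc.2 hT) hT
  -- At time `0` the process is in state `0` with probability one.
  have hW0 : W 0 = poissonCdfPrimitive J.card (l 0) := by
    simp only [hW, intervalIntegral.integral_same, add_zero, hK]
    rw [Finset.sum_range_succ', hm0]
    simp [poissonWeight]
  have hWT : ∫ t in (0 : ℝ)..T, h t * F t ≤ W T := by
    have : 0 ≤ ∑ k ∈ Finset.range K, poissonWeight k T * poissonCdfPrimitive (m k) (l T) :=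
      Finset.sum_nonneg fun k _ => mul_nonneg (poissonWeight_nonneg k hT)
        (poissonCdfPrimitive_nonneg _ (hlnn T le_rfl))
    simp only [hW]
    linarith
  rw [hW0] at hfin
  exact hWT.trans hfin

/-! ### Poisson masses of measurable sets -/

/-- The integral of the weight `poissonWeight k` over a set. -/
noncomputable def poissonMass (S : Set ℝ) (k : ℕ) : ℝ := ∫ t in S, poissonWeight k t

theorem integrableOn_poissonWeight {S : Set ℝ} (hS : MeasurableSet S) (hS0 : S ⊆ Ioi 0)
    (hfin : volume S ≠ ∞) (k : ℕ) : IntegrableOn (poissonWeight k) S := by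
  refine Measure.integrableOn_of_bounded hfin (continuous_poissonWeight k).aestronglyMeasurable
    (M := 1) ?_
  filter_upwards [ae_restrict_mem hS] with t ht
  have h0 : 0 ≤ t := le_of_lt (hS0 ht)
  rw [Real.norm_of_nonneg (poissonWeight_nonneg k h0)]
  simpa using sum_poissonWeight_le_one {k} h0

/-- The indicator of `S` is approximated in `L¹` by continuous controls. Since the weights sum to at
most one, an `L¹` error `ε` costs at most `ε` in the integral, and the budget grows by at most `ε`.
-/
theorem sum_poissonMass_le {S : Set ℝ} (hS : MeasurableSet S) (hS0 : S ⊆ Ioi 0)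
    (hfin : volume S ≠ ∞) (J : Finset ℕ) :
    ∑ j ∈ J, poissonMass S j ≤ poissonCdfPrimitive J.card (volume S).toReal := by
  set L := (volume S).toReal with hL
  set F : ℝ → ℝ := fun t => ∑ j ∈ J, poissonWeight j t with hF
  have hFc : Continuous F := continuous_finsetSum _ fun j _ => continuous_poissonWeight j
  have hF0 : ∀ t, 0 ≤ t → 0 ≤ F t := fun t ht =>
    Finset.sum_nonneg fun _ _ => poissonWeight_nonneg _ ht
  have hF1 : ∀ t, 0 ≤ t → F t ≤ 1 := fun t ht => sum_poissonWeight_le_one J ht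
  have hsum : ∑ j ∈ J, poissonMass S j = ∫ t in S, F t := by
    simp only [poissonMass, hF]
    rw [integral_finsetSum _ fun j _ => integrableOn_poissonWeight hS hS0 hfin j]
  rw [hsum]
  set χ : ℝ → ℝ := S.indicator 1 with hχ
  have hχi : Integrable χ := (integrable_indicator_iff hS).2 (integrableOn_const hfin)
  have hχL : ∫ t, χ t = L := by
    rw [hχ, integral_indicator_one hS]; rfl
  have key : ∀ ε : ℝ, 0 < ε → ∫ t in S, F t ≤ poissonCdfPrimitive J.card (L + ε) + ε := by
    intro ε hε
    obtain ⟨g, hgs, hgi, hgc, -⟩ := hχi.exists_hasCompactSupport_integral_sub_le hε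
    -- Clamping to `[0, 1]` only brings `g` closer to `χ`, whose values are `0` and `1`.
    set h : ℝ → ℝ := fun t => max 0 (min 1 (g t)) with hh
    have hc : Continuous h := by fun_prop
    have h0 : ∀ t, 0 ≤ h t := fun t => le_max_left _ _
    have h1 : ∀ t, h t ≤ 1 := fun t => max_le zero_le_one (min_le_left _ _)
    have hhs : HasCompactSupport h := hgs.comp_left (g := fun x => max 0 (min 1 x)) (by simp)
    have hhi : Integrable h := hc.integrable_of_hasCompactSupport hhs
    have hle : ∀ t, |χ t - h t| ≤ ‖χ t - g t‖ := by
      intro t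
      rw [Real.norm_eq_abs]
      have : χ t = 0 ∨ χ t = 1 := by
        by_cases ht : t ∈ S <;> simp [hχ, ht]
      simp only [hh]
      rcases this with e | e <;> rw [e] <;> grind
    have hdi : Integrable fun t => |χ t - h t| := (hχi.sub hhi).abs
    have hdε : ∫ t, |χ t - h t| ≤ ε := by
      refine (integral_mono hdi ?_ hle).trans hgi
      exact (hχi.sub (hgc.integrable_of_hasCompactSupport hgs)).norm
    obtain ⟨R, hR⟩ := hhs.isBounded.subset_closedBall 0
    set T := max R 0 with hTdef
    have hT : 0 ≤ T := le_max_right _ _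
    have hzero : ∀ t, T < t → h t = 0 := by
      intro t ht
      by_contra hne
      have := hR (subset_tsupport h hne)
      rw [Metric.mem_closedBall, dist_zero_right, Real.norm_eq_abs] at this
      have : t ≤ R := (le_abs_self t).trans this
      linarith [le_max_left R 0]
    have hmain := integral_mul_sum_poissonWeight_le hc h0 h1 hT J
    have hhT : ∫ t in (0 : ℝ)..T, h t ≤ L + ε := by
      rw [intervalIntegral.integral_of_le hT]
      calc ∫ t in Ioc 0 T, h t ≤ ∫ t, h t :=
            setIntegral_le_integral hhi (Eventually.of_forall h0)
        _ ≤ ∫ t, (χ t + |χ t - h t|) := by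
            refine integral_mono hhi (hχi.add hdi) fun t => ?_
            have := neg_abs_le (χ t - h t)
            simp only
            linarith
        _ ≤ L + ε := by rw [integral_add hχi hdi, hχL]; linarith
    have hmono := monotoneOn_poissonCdfPrimitive J.card
      (show (∫ t in (0 : ℝ)..T, h t) ∈ Ici 0 from
        intervalIntegral.integral_nonneg hT fun t _ => h0 t)
      (show L + ε ∈ Ici 0 from add_nonneg ENNReal.toReal_nonneg hε.le) hhT
    have hFh : IntegrableOn (fun t => h t * F t) (Ioi 0) := by
      exact ((hc.mul hFc).integrable_of_hasCompactSupport hhs.mul_right).integrableOn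
    have hχF : ∫ t in S, F t = ∫ t in Ioi 0, χ t * F t := by
      have e : ∀ t, χ t * F t = S.indicator F t := by
        intro t; by_cases ht : t ∈ S <;> simp [hχ, ht]
      simp only [e]
      rw [setIntegral_indicator hS, inter_eq_right.2 hS0]
    have hχFi : IntegrableOn (fun t => χ t * F t) (Ioi 0) := by
      refine Integrable.mono' hχi.integrableOn
        (hχi.aestronglyMeasurable.mul hFc.aestronglyMeasurable).restrict ?_
      filter_upwards [ae_restrict_mem measurableSet_Ioi] with t ht
      have hχ0 : 0 ≤ χ t := indicator_nonneg (fun _ _ => zero_le_one) t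
      rw [norm_mul, Real.norm_of_nonneg hχ0, Real.norm_of_nonneg (hF0 t (le_of_lt ht))]
      exact mul_le_of_le_one_right hχ0 (hF1 t (le_of_lt ht))
    have hIoi : ∫ t in Ioi 0, h t * F t = ∫ t in (0 : ℝ)..T, h t * F t := by
      rw [intervalIntegral.integral_of_le hT]
      refine setIntegral_eq_of_subset_of_forall_sdiff_eq_zero measurableSet_Ioi
        (fun t ht => ht.1) fun t ht => ?_
      rw [hzero t (by
        by_contra hle
        exact ht.2 ⟨ht.1, not_lt.1 hle⟩), zero_mul]
    calc ∫ t in S, F t = ∫ t in Ioi 0, χ t * F t := hχF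
      _ ≤ ∫ t in Ioi 0, (h t * F t + |χ t - h t|) := by
          refine setIntegral_mono_on hχFi (hFh.add hdi.integrableOn) measurableSet_Ioi
            fun t ht => ?_
          have e1 := hF0 t (le_of_lt ht)
          have e2 := hF1 t (le_of_lt ht)
          have e3 := le_abs_self (χ t - h t)
          have e4 : (χ t - h t) * F t ≤ |χ t - h t| :=
            (mul_le_mul_of_nonneg_right e3 e1).trans
              (mul_le_of_le_one_right (abs_nonneg _) e2)
          linarith
      _ = (∫ t in Ioi 0, h t * F t) + ∫ t in Ioi 0, |χ t - h t| :=
          integral_add hFh hdi.integrableOn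
      _ ≤ poissonCdfPrimitive J.card (L + ε) + ε := by
          refine add_le_add (by rw [hIoi]; exact hmain.trans hmono) ?_
          exact (setIntegral_le_integral hdi (Eventually.of_forall fun _ => abs_nonneg _)).trans hdε
  have hlim : Tendsto (fun ε => poissonCdfPrimitive J.card (L + ε) + ε) (𝓝[>] 0)
      (𝓝 (poissonCdfPrimitive J.card L)) := by
    have hcont : Continuous fun ε => poissonCdfPrimitive J.card (L + ε) + ε :=
      ((continuous_poissonCdfPrimitive _).comp (by fun_prop)).add continuous_id
    have := (hcont.tendsto 0).mono_left (nhdsWithin_le_nhds (s := Ioi 0))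
    simpa using this
  exact ge_of_tendsto hlim (eventually_nhdsWithin_of_forall fun ε hε => key ε hε)

/-- This identifies the eigenvalues of the disc with the summands of `poissonCdfPrimitive`. -/
theorem poissonMass_Ioo {L : ℝ} (hL : 0 ≤ L) (k : ℕ) :
    poissonMass (Ioo 0 L) k = 1 - poissonCdf (k + 1) L := by
  rw [poissonMass, ← integral_Ioc_eq_integral_Ioo, ← intervalIntegral.integral_of_le hL,
    intervalIntegral.integral_eq_sub_of_hasDerivAt (f := fun t => - poissonCdf (k + 1) t)
      (fun t _ => by simpa using (hasDerivAt_poissonCdf_succ k t).fun_neg)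
      ((continuous_poissonWeight k).intervalIntegrable _ _), poissonCdf_succ_zero]
  ring

theorem antitone_poissonMass_Ioo {L : ℝ} (hL : 0 ≤ L) : Antitone (poissonMass (Ioo 0 L)) := by
  refine antitone_nat_of_succ_le fun k => ?_
  rw [poissonMass_Ioo hL, poissonMass_Ioo hL, poissonCdf, poissonCdf,
    Finset.sum_range_succ _ (k + 1)]
  linarith [poissonWeight_nonneg (k + 1) hL]

theorem sum_poissonMass_Ioo {L : ℝ} (hL : 0 ≤ L) (n : ℕ) :
    ∑ k ∈ Finset.range n, poissonMass (Ioo 0 L) k = poissonCdfPrimitive n L :=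
  Finset.sum_congr rfl fun k _ => poissonMass_Ioo hL k

theorem poissonMass_Ioo_lt_one {L : ℝ} (hL : 0 ≤ L) (k : ℕ) : poissonMass (Ioo 0 L) k < 1 := by
  rw [poissonMass_Ioo hL, poissonCdf, Finset.sum_range_succ']
  have : 0 < poissonWeight 0 L := by simp [poissonWeight, Real.exp_pos]
  have := Finset.sum_nonneg (s := Finset.range k) fun i _ => poissonWeight_nonneg (i + 1) hL
  linarith

theorem poissonMass_pos {S : Set ℝ} (hS : MeasurableSet S) (hS0 : S ⊆ Ioi 0)
    (hpos : volume S ≠ 0) (hfin : volume S ≠ ∞) (k : ℕ) : 0 < poissonMass S k := by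
  have hpw : ∀ t ∈ S, 0 < poissonWeight k t := fun t ht => by
    have : 0 < t := hS0 ht
    unfold poissonWeight; positivity
  rw [poissonMass, setIntegral_pos_iff_support_of_nonneg_ae
    ((ae_restrict_mem hS).mono fun t ht => (hpw t ht).le)
    (integrableOn_poissonWeight hS hS0 hfin k)]
  rw [inter_eq_right.2 fun t ht => Function.mem_support.2 (hpw t ht).ne']
  exact pos_iff_ne_zero.2 hpos

/-! ### Weak majorization and Karamata's inequality -/

/-- The right derivative serves as `c`, so `Φ` need not be differentiable. -/
theorem exists_subgradient_of_monotoneOn {Φ : ℝ → ℝ} {s : Set ℝ} (hs : IsOpen s)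
    (hconv : ConvexOn ℝ s Φ) (hmono : MonotoneOn Φ s) :
    ∃ c : ℝ → ℝ, (∀ x ∈ s, 0 ≤ c x) ∧ MonotoneOn c s ∧
      ∀ x ∈ s, ∀ y ∈ s, c x * (y - x) ≤ Φ y - Φ x := by
  set c : ℝ → ℝ := fun x => derivWithin Φ (Ioi x) x with hc
  have hsub : ∀ x ∈ s, ∀ y ∈ s, c x * (y - x) ≤ Φ y - Φ x := by
    intro x hx y hy
    have hxi : x ∈ interior s := by rwa [hs.interior_eq]
    rcases lt_trichotomy x y with h | h | h
    · have := hconv.rightDeriv_le_slope_of_mem_interior hxi hy h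
      rw [slope_def_field, le_div_iff₀ (by linarith)] at this
      exact this
    · simp [h]
    · have h1 := hconv.slope_le_leftDeriv_of_mem_interior hy hxi h
      have h2 := h1.trans (hconv.leftDeriv_le_rightDeriv_of_mem_interior hxi)
      rw [slope_def_field, div_le_iff₀ (by linarith)] at h2
      simp only [hc]
      linarith
  refine ⟨c, fun x hx => ?_, fun x hx y hy hxy => ?_, hsub⟩
  · obtain ⟨ε, hε, hball⟩ := Metric.isOpen_iff.1 hs x hx
    -- Openness supplies a point to the left of `x`; comparing `Φ` there with `Φ x` gives the sign
    -- of `c x`.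
    have hy : x - ε / 2 ∈ s := hball (by
      rw [Metric.mem_ball, Real.dist_eq, abs_lt]; constructor <;> linarith)
    have h1 := hsub x hx _ hy
    have h2 := hmono hy hx (by linarith)
    nlinarith
  · rcases hxy.eq_or_lt with h | h
    · rw [h]
    · have h1 := hsub x hx y hy
      have h2 := hsub y hy x hx
      nlinarith

/-- Abel summation: lowering the coefficient of a nonnegative partial sum from `c n` to `c (n + 1)`
cannot increase the total. -/
theorem mul_sum_le_sum_mul_of_antitone {c d : ℕ → ℝ} {n : ℕ}
    (hc : ∀ k, k < n → c (k + 1) ≤ c k)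
    (hd : ∀ m, m ≤ n + 1 → 0 ≤ ∑ k ∈ Finset.range m, d k) :
    c n * ∑ k ∈ Finset.range (n + 1), d k ≤ ∑ k ∈ Finset.range (n + 1), c k * d k := by
  induction n with
  | zero => simp
  | succ n ih =>
    have h1 := ih (fun k hk => hc k (by omega)) (fun m hm => hd m (by omega))
    rw [Finset.sum_range_succ, Finset.sum_range_succ (fun k => c k * d k), mul_add]
    have h2 := mul_le_mul_of_nonneg_right (hc n (by omega)) (hd (n + 1) (by omega))
    linarith

/-- Weak majorization: Karamata's inequality for convex monotone functions. -/
theorem sum_le_sum_of_weakly_majorized {Φ : ℝ → ℝ} {s : Set ℝ} (hs : IsOpen s)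
    (hconv : ConvexOn ℝ s Φ) (hmono : MonotoneOn Φ s) {x y : ℕ → ℝ}
    (hx : ∀ k, x k ∈ s) (hy : ∀ k, y k ∈ s) (hanti : Antitone x)
    (hmaj : ∀ m, ∑ k ∈ Finset.range m, x k ≤ ∑ k ∈ Finset.range m, y k) (n : ℕ) :
    ∑ k ∈ Finset.range n, Φ (x k) ≤ ∑ k ∈ Finset.range n, Φ (y k) := by
  obtain ⟨c, hc0, hcm, hsub⟩ := exists_subgradient_of_monotoneOn hs hconv hmono
  rcases n with _ | n
  · simp
  have hd : ∀ m, 0 ≤ ∑ k ∈ Finset.range m, (y k - x k) := fun m => by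
    rw [Finset.sum_sub_distrib]; linarith [hmaj m]
  have h1 := mul_sum_le_sum_mul_of_antitone (c := fun k => c (x k)) (d := fun k => y k - x k)
    (n := n) (fun k _ => hcm (hx _) (hx _) (hanti k.le_succ)) fun m _ => hd m
  have h2 := mul_nonneg (hc0 _ (hx n)) (hd (n + 1))
  have h3 : ∑ k ∈ Finset.range (n + 1), c (x k) * (y k - x k) ≤
      ∑ k ∈ Finset.range (n + 1), (Φ (y k) - Φ (x k)) :=
    Finset.sum_le_sum fun k _ => hsub _ (hx k) _ (hy k)
  rw [Finset.sum_sub_distrib] at h3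
  linarith

/-! ### Decreasing enumeration of a null sequence -/

/-- The `k`-th largest term (`k = 1, 2, …`), with multiplicity, of a positive sequence tending
to zero. -/
noncomputable def nthLargest (μ : ℕ → ℝ) (k : ℕ) : ℝ :=
  sSup {t : ℝ | 0 < t ∧ k ≤ {n | t ≤ μ n}.ncard}

/-- The case `k = 0` must be excluded: there the set of admissible `t` is unbounded above. -/
theorem le_of_mem_nthLargest {μ : ℕ → ℝ} {M : ℝ} (hM : ∀ n, μ n ≤ M) {k : ℕ} (hk : 1 ≤ k) :
    ∀ t ∈ {t : ℝ | 0 < t ∧ k ≤ {n | t ≤ μ n}.ncard}, t ≤ M := by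
  rintro t ⟨-, ht⟩
  have : {n | t ≤ μ n}.Nonempty := nonempty_of_ncard_ne_zero (by omega)
  obtain ⟨n, hn⟩ := this
  exact le_trans hn (hM n)

theorem exists_mem_nthLargest {μ : ℕ → ℝ} (hfin : ∀ t, 0 < t → {n | t ≤ μ n}.Finite)
    (hpos : ∀ n, 0 < μ n) (k : ℕ) : ∃ t : ℝ, 0 < t ∧ k ≤ {n | t ≤ μ n}.ncard := by
  obtain ⟨t, ht, hle⟩ : ∃ t : ℝ, 0 < t ∧ ∀ n < k, t ≤ μ n := by
    induction k with
    | zero => exact ⟨1, one_pos, by simp⟩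
    | succ k ih =>
      obtain ⟨t, ht, hle⟩ := ih
      refine ⟨min t (μ k), lt_min ht (hpos k), fun n hn => ?_⟩
      rcases Nat.lt_succ_iff_lt_or_eq.1 hn with h | rfl
      · exact (min_le_left _ _).trans (hle n h)
      · exact min_le_right _ _
  refine ⟨t, ht, ?_⟩
  calc k = (↑(Finset.range k) : Set ℕ).ncard := by rw [ncard_coe_finset, Finset.card_range]
    _ ≤ _ := ncard_le_ncard (fun n hn => hle n (by simpa using hn)) (hfin t ht)

theorem nthLargest_pos {μ : ℕ → ℝ} (hfin : ∀ t, 0 < t → {n | t ≤ μ n}.Finite)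
    {M : ℝ} (hM : ∀ n, μ n ≤ M) (hpos : ∀ n, 0 < μ n) {k : ℕ} (hk : 1 ≤ k) :
    0 < nthLargest μ k := by
  obtain ⟨t, ht⟩ := exists_mem_nthLargest hfin hpos k
  exact ht.1.trans_le (le_csSup ⟨M, le_of_mem_nthLargest hM hk⟩ ht)

theorem nthLargest_le {μ : ℕ → ℝ} (hfin : ∀ t, 0 < t → {n | t ≤ μ n}.Finite)
    {M : ℝ} (hM : ∀ n, μ n ≤ M) (hpos : ∀ n, 0 < μ n) {k : ℕ} (hk : 1 ≤ k) :
    nthLargest μ k ≤ M :=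
  csSup_le (exists_mem_nthLargest hfin hpos k) (le_of_mem_nthLargest hM hk)

theorem nthLargest_anti {μ : ℕ → ℝ} (hfin : ∀ t, 0 < t → {n | t ≤ μ n}.Finite)
    {M : ℝ} (hM : ∀ n, μ n ≤ M) (hpos : ∀ n, 0 < μ n) {k l : ℕ} (hk : 1 ≤ k)
    (hkl : k ≤ l) : nthLargest μ l ≤ nthLargest μ k :=
  csSup_le_csSup ⟨M, le_of_mem_nthLargest hM hk⟩ (exists_mem_nthLargest hfin hpos l)
    fun _ ht => ⟨ht.1, hkl.trans ht.2⟩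

/-- The indices are picked greedily: a level within `ε` of the `(m + 1)`-st supremum is reached by
at least `m + 1` indices, so one of them is outside the `m` already chosen. Finiteness of level sets
matters since `ncard` is `0` on infinite sets. -/
theorem exists_card_sum_nthLargest_le {μ : ℕ → ℝ} (hfin : ∀ t, 0 < t → {n | t ≤ μ n}.Finite)
    (hpos : ∀ n, 0 < μ n) (m : ℕ) {ε : ℝ} (hε : 0 < ε) :
    ∃ J : Finset ℕ, J.card = m ∧
      ∑ k ∈ Finset.range m, nthLargest μ (k + 1) ≤ ∑ j ∈ J, μ j + m * ε := by
  induction m with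
  | zero => exact ⟨∅, by simp⟩
  | succ m ih =>
    obtain ⟨J, hJ, hsum⟩ := ih
    obtain ⟨t, ⟨ht0, ht⟩, hlt⟩ := exists_lt_of_lt_csSup
      (exists_mem_nthLargest hfin hpos (m + 1))
      (show nthLargest μ (m + 1) - ε < sSup _ from sub_lt_self _ hε)
    obtain ⟨x, hx, hxJ⟩ := exists_mem_notMem_of_ncard_lt_ncard
      (s := (J : Set ℕ)) (t := {n | t ≤ μ n}) (by rw [ncard_coe_finset]; omega)
    refine ⟨insert x J, by rw [Finset.card_insert_of_notMem (by simpa using hxJ), hJ], ?_⟩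
    rw [Finset.sum_range_succ, Finset.sum_insert (by simpa using hxJ)]
    have : t ≤ μ x := hx
    push_cast
    linarith

theorem nthLargest_eq_of_antitone {μ : ℕ → ℝ} (hfin : ∀ t, 0 < t → {n | t ≤ μ n}.Finite)
    (hpos : ∀ n, 0 < μ n) (hanti : Antitone μ) (k : ℕ) :
    nthLargest μ (k + 1) = μ k := by
  refine IsGreatest.csSup_eq ⟨⟨hpos k, ?_⟩, ?_⟩
  · calc k + 1 = (↑(Finset.range (k + 1)) : Set ℕ).ncard := by
          rw [ncard_coe_finset, Finset.card_range]
      _ ≤ _ := ncard_le_ncard (fun n hn => hanti (by simpa [Nat.lt_succ_iff] using hn))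
          (hfin _ (hpos k))
  · rintro t ⟨ht0, ht⟩
    by_contra! hlt
    have hsub : {n | t ≤ μ n} ⊆ (↑(Finset.range k) : Set ℕ) := by
      intro n hn
      simp only [Finset.coe_range, mem_Iio]
      by_contra! h
      exact absurd (le_trans hn (hanti h)) (not_le.2 hlt)
    have := ncard_le_ncard hsub (Finset.finite_toSet _)
    rw [ncard_coe_finset, Finset.card_range] at this
    omega

/-! ### Eigenvalues of a diagonal operator -/

/-- An operator that is diagonal in a complete orthogonal family has the diagonal entries as
its eigenvalues. -/
theorem nthEigenvalue_eq_nthLargest {H : Type*} [NormedAddCommGroup H] [InnerProductSpace ℂ H]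
    {T : H →ₗ[ℂ] H} (hT : T.IsSymmetric) {e : ℕ → H} {μ : ℕ → ℝ}
    (he0 : ∀ n, e n ≠ 0) (horth : Pairwise fun m n => inner ℂ (e m) (e n) = 0)
    (hcomplete : ∀ f : H, (∀ n, inner ℂ (e n) f = 0) → f = 0)
    (hTe : ∀ n, T (e n) = (μ n : ℂ) • e n) (hfin : ∀ t, 0 < t → {n | t ≤ μ n}.Finite) (k : ℕ) :
    nthEigenvalue T k = nthLargest μ k := by
  unfold nthEigenvalue nthLargest
  congr 1
  ext t
  refine and_congr_right fun ht => ?_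
  have hspan : (⨆ s ∈ Ici t, Module.End.eigenspace T ((s : ℝ) : ℂ)) =
      Submodule.span ℂ (e '' {n | t ≤ μ n}) := by
    apply le_antisymm
    · refine iSup₂_le fun s hs f hf => ?_
      rw [Module.End.mem_eigenspace_iff] at hf
      -- By symmetry, an eigenvector is orthogonal to every `e n` with a different eigenvalue.
      have hcoef : ∀ n, μ n < t → inner ℂ (e n) f = 0 := by
        intro n hn
        have h1 := hT (e n) f
        rw [hTe, hf, inner_smul_left, inner_smul_right, Complex.conj_ofReal] at h1
        have h2 : ((μ n : ℂ) - s) * inner ℂ (e n) f = 0 := by rw [sub_mul, h1, sub_self]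
        refine (mul_eq_zero.1 h2).resolve_left ?_
        rw [← Complex.ofReal_sub, Complex.ofReal_eq_zero]
        have : t ≤ s := hs
        linarith
      set A := (hfin t ht).toFinset with hA
      -- Only finitely many coefficients survive, so a finite sum and completeness replace a Hilbert
      -- basis expansion.
      set g := ∑ n ∈ A, (inner ℂ (e n) f / inner ℂ (e n) (e n)) • e n with hg
      have hfg : f - g = 0 := by
        refine hcomplete _ fun n => ?_
        rw [inner_sub_right, hg, inner_sum]
        simp only [inner_smul_right]
        by_cases hn : n ∈ A
        · rw [Finset.sum_eq_single_of_mem n hn fun m _ hmn => by rw [horth hmn.symm, mul_zero],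
            div_mul_cancel₀ _ (inner_self_ne_zero.2 (he0 n)), sub_self]
        · rw [Finset.sum_eq_zero fun m hm => by
            rw [horth (i := n) (j := m) (fun h => hn (h ▸ hm)), mul_zero], sub_zero]
          exact hcoef n (by simpa [hA] using hn)
      rw [sub_eq_zero.1 hfg]
      refine Submodule.sum_mem _ fun n hn => Submodule.smul_mem _ _ (Submodule.subset_span ?_)
      exact mem_image_of_mem _ (by simpa [hA] using hn)
    · rw [Submodule.span_le]
      rintro _ ⟨n, hn, rfl⟩
      refine Submodule.mem_iSup_of_mem (μ n) (Submodule.mem_iSup_of_mem hn ?_)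
      exact Module.End.mem_eigenspace_iff.2 (hTe n)
  have hli : LinearIndependent ℂ e := linearIndependent_of_ne_zero_of_inner_eq_zero he0 horth
  have hrank : Module.rank ℂ (Submodule.span ℂ (e '' {n | t ≤ μ n})) =
      ({n | t ≤ μ n}.ncard : Cardinal) := by
    have h := rank_span (hli.comp (Subtype.val : {n | t ≤ μ n} → ℕ) Subtype.val_injective)
    rw [range_comp, Subtype.range_coe] at h
    rw [h, ← cast_ncard ((hfin t ht).image e), ncard_image_of_injective _ hli.injective]
  rw [hspan, hrank, Nat.cast_le]

/-! ### Area as the radial coordinate -/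

theorem volume_pi_mul_norm_sq_lt (b : ℝ) :
    volume {z : ℂ | Real.pi * ‖z‖ ^ 2 < b} = ENNReal.ofReal b := by
  have hpi := Real.pi_pos
  rcases le_or_gt b 0 with hb | hb
  · have : {z : ℂ | Real.pi * ‖z‖ ^ 2 < b} = ∅ := by
      ext z
      simp only [mem_ofPred_eq, mem_empty_iff_false, iff_false, not_lt]
      exact hb.trans (by positivity)
    rw [this, measure_empty, ENNReal.ofReal_of_nonpos hb]
  · have : {z : ℂ | Real.pi * ‖z‖ ^ 2 < b} = Metric.ball 0 (√(b / Real.pi)) := by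
      ext z
      simp only [mem_ofPred_eq, mem_ball_zero_iff]
      rw [Real.lt_sqrt (norm_nonneg z), lt_div_iff₀ hpi, mul_comm]
    rw [this, Complex.volume_ball, ← ENNReal.ofReal_pow (Real.sqrt_nonneg _),
      Real.sq_sqrt (by positivity), ← ENNReal.ofReal_coe_nnreal,
      ← ENNReal.ofReal_mul (by positivity)]
    congr 1
    simp

theorem volume_pi_mul_norm_sq_le (a : ℝ) :
    volume {z : ℂ | Real.pi * ‖z‖ ^ 2 ≤ a} = ENNReal.ofReal a := by
  have hpi := Real.pi_pos
  rcases lt_or_ge a 0 with ha | ha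
  · have : {z : ℂ | Real.pi * ‖z‖ ^ 2 ≤ a} = ∅ := by
      ext z
      simp only [mem_ofPred_eq, mem_empty_iff_false, iff_false, not_le]
      exact ha.trans_le (by positivity)
    rw [this, measure_empty, ENNReal.ofReal_of_nonpos ha.le]
  · have : {z : ℂ | Real.pi * ‖z‖ ^ 2 ≤ a} = Metric.closedBall 0 (√(a / Real.pi)) := by
      ext z
      simp only [mem_ofPred_eq, mem_closedBall_zero_iff]
      rw [Real.le_sqrt (norm_nonneg z) (by positivity), le_div_iff₀ hpi, mul_comm]
    rw [this, Complex.volume_closedBall, ← ENNReal.ofReal_pow (Real.sqrt_nonneg _),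
      Real.sq_sqrt (by positivity), ← ENNReal.ofReal_coe_nnreal,
      ← ENNReal.ofReal_mul (by positivity)]
    congr 1
    simp

/-- The area of the disc of radius `‖z‖` is distributed uniformly on `(0, ∞)`. -/
theorem map_pi_mul_norm_sq :
    Measure.map (fun z : ℂ => Real.pi * ‖z‖ ^ 2) volume = volume.restrict (Ioi (0 : ℝ)) := by
  symm
  refine Real.measure_ext_Ioo_rat fun a b => ?_
  have hm : Measurable fun z : ℂ => Real.pi * ‖z‖ ^ 2 := by fun_prop
  rw [Measure.map_apply hm measurableSet_Ioo, Measure.restrict_apply measurableSet_Ioo,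
    Ioo_inter_Ioi, Real.volume_Ioo]
  rcases le_or_gt (b : ℝ) a with h | h
  · rw [Ioo_eq_empty (not_lt.2 h), preimage_empty, measure_empty,
      ENNReal.ofReal_of_nonpos (by linarith [le_max_left (a : ℝ) 0])]
  · have e : (fun z : ℂ => Real.pi * ‖z‖ ^ 2) ⁻¹' Ioo (a : ℝ) b =
        {z : ℂ | Real.pi * ‖z‖ ^ 2 < b} \ {z : ℂ | Real.pi * ‖z‖ ^ 2 ≤ a} := by
      ext z
      simp [and_comm]
    rw [e, measure_sdiff (s₁ := {z : ℂ | Real.pi * ‖z‖ ^ 2 < b})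
      (s₂ := {z : ℂ | Real.pi * ‖z‖ ^ 2 ≤ a})
      (fun z (hz : Real.pi * ‖z‖ ^ 2 ≤ a) => show Real.pi * ‖z‖ ^ 2 < b from hz.trans_lt h)
      (measurableSet_le hm measurable_const).nullMeasurableSet
      (by rw [volume_pi_mul_norm_sq_le]; exact ENNReal.ofReal_ne_top),
      volume_pi_mul_norm_sq_le, volume_pi_mul_norm_sq_lt, ENNReal.ofReal_sub _ (le_max_right _ _)]
    congr 1
    rcases le_total (a : ℝ) 0 with ha | ha
    · rw [max_eq_right ha, ENNReal.ofReal_zero, ENNReal.ofReal_of_nonpos ha]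
    · rw [max_eq_left ha]

theorem poissonWeight_eq_rpow (n : ℕ) (t : ℝ) :
    poissonWeight n t = (Real.exp (-t) * t ^ ((n : ℝ) + 1 - 1)) / n.factorial := by
  rw [poissonWeight, add_sub_cancel_right, Real.rpow_natCast, mul_comm]

theorem integrableOn_poissonWeight_Ioi (n : ℕ) : IntegrableOn (poissonWeight n) (Ioi 0) := by
  have := (Real.GammaIntegral_convergent (s := (n : ℝ) + 1) (by positivity)).div_const
    (n.factorial : ℝ)
  exact this.congr (Eventually.of_forall fun t => (poissonWeight_eq_rpow n t).symm)

theorem poissonMass_Ioi (n : ℕ) : poissonMass (Ioi 0) n = 1 := by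
  have h := Real.Gamma_eq_integral (s := (n : ℝ) + 1) (by positivity)
  rw [Real.Gamma_nat_eq_factorial] at h
  simp only [poissonMass, poissonWeight_eq_rpow]
  rw [integral_div, ← h, div_self (by positivity)]

/-! ### Gaussian moments of radial sets -/

/-- The circularly symmetric set around `0` described by the areas of its circles. -/
def radialSet (S : Set ℝ) : Set ℂ := {u | Real.pi * ‖u‖ ^ 2 ∈ S}

theorem measurableSet_radialSet {S : Set ℝ} (hS : MeasurableSet S) :
    MeasurableSet (radialSet S) :=
  (by fun_prop : Measurable fun z : ℂ => Real.pi * ‖z‖ ^ 2) hS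

theorem volume_radialSet {S : Set ℝ} (hS : MeasurableSet S) (hS0 : S ⊆ Ioi 0) :
    volume (radialSet S) = volume S := by
  have h := Measure.map_apply (μ := (volume : Measure ℂ))
    (by fun_prop : Measurable fun z : ℂ => Real.pi * ‖z‖ ^ 2) hS
  rw [map_pi_mul_norm_sq, Measure.restrict_apply hS, inter_eq_left.2 hS0] at h
  exact h.symm

theorem norm_pow_mul_exp_eq_poissonWeight (n : ℕ) (u : ℂ) :
    ‖u‖ ^ (2 * n) * Real.exp (-Real.pi * ‖u‖ ^ 2) =
      n.factorial / Real.pi ^ n * poissonWeight n (Real.pi * ‖u‖ ^ 2) := by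
  have := Real.pi_pos
  rw [poissonWeight, mul_pow, ← pow_mul, neg_mul]
  field_simp

theorem conj_pow_mul_pow_mul_exp (n : ℕ) (u : ℂ) :
    (starRingEnd ℂ) u ^ n * u ^ n * (Real.exp (-Real.pi * ‖u‖ ^ 2) : ℂ) =
      ((n.factorial / Real.pi ^ n * poissonWeight n (Real.pi * ‖u‖ ^ 2) : ℝ) : ℂ) := by
  rw [← norm_pow_mul_exp_eq_poissonWeight, ← mul_pow, Complex.conj_mul']
  push_cast
  rw [pow_mul]

theorem integrable_norm_pow_mul_exp (n : ℕ) :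
    Integrable fun u : ℂ => ‖u‖ ^ (2 * n) * Real.exp (-Real.pi * ‖u‖ ^ 2) := by
  simp only [norm_pow_mul_exp_eq_poissonWeight]
  refine Integrable.const_mul ?_ _
  have h : Integrable (poissonWeight n)
      (Measure.map (fun z : ℂ => Real.pi * ‖z‖ ^ 2) volume) := by
    rw [map_pi_mul_norm_sq]
    exact integrableOn_poissonWeight_Ioi n
  exact h.comp_measurable (by fun_prop)

theorem integral_radialSet_self {S : Set ℝ} (hS : MeasurableSet S) (hS0 : S ⊆ Ioi 0) (n : ℕ) :
    ∫ u in radialSet S, (starRingEnd ℂ) u ^ n * u ^ n * (Real.exp (-Real.pi * ‖u‖ ^ 2) : ℂ) =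
      ((n.factorial / Real.pi ^ n * poissonMass S n : ℝ) : ℂ) := by
  simp only [conj_pow_mul_pow_mul_exp]
  rw [integral_complex_ofReal, integral_const_mul]
  congr 2
  have h := setIntegral_map (μ := (volume : Measure ℂ)) (f := poissonWeight n)
    (g := fun z : ℂ => Real.pi * ‖z‖ ^ 2) hS
    (continuous_poissonWeight n).aestronglyMeasurable (by fun_prop)
  rw [map_pi_mul_norm_sq, Measure.restrict_restrict hS, inter_eq_left.2 hS0] at h
  exact h.symm

/-- A suitable rotation preserves the domain and the Gaussian and changes the sign of the integrand.
-/
theorem integral_radialSet_of_ne {S : Set ℝ} (hS : MeasurableSet S) {n m : ℕ} (hnm : n ≠ m) :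
    ∫ u in radialSet S, (starRingEnd ℂ) u ^ n * u ^ m *
      (Real.exp (-Real.pi * ‖u‖ ^ 2) : ℂ) = 0 := by
  rw [← integral_indicator (measurableSet_radialSet hS)]
  set f : ℂ → ℂ := (radialSet S).indicator fun u => (starRingEnd ℂ) u ^ n * u ^ m *
      (Real.exp (-Real.pi * ‖u‖ ^ 2) : ℂ) with hf
  have hd : (m : ℝ) - n ≠ 0 := by
    rw [sub_ne_zero]
    exact_mod_cast hnm.symm
  -- With this angle, `e^{i(m - n)α} = e^{iπ} = -1`.
  set α : ℝ := Real.pi / (m - n) with hα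
  set a : Circle := Circle.exp α with ha
  have hfac : (starRingEnd ℂ) (a : ℂ) ^ n * (a : ℂ) ^ m = -1 := by
    rw [ha, Circle.coe_exp, ← Complex.exp_conj, ← Complex.exp_nat_mul, ← Complex.exp_nat_mul,
      ← Complex.exp_add, ← Complex.exp_pi_mul_I]
    congr 1
    have hd' : (m : ℂ) - n ≠ 0 := by exact_mod_cast hd
    simp only [hα, map_mul, Complex.conj_ofReal, Complex.conj_I]
    push_cast
    field_simp
    ring
  have hrot : ∀ u, f (rotation a u) = -f u := by
    intro u
    have hn : ‖(a : ℂ) * u‖ = ‖u‖ := by rw [norm_mul, Circle.norm_coe, one_mul]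
    have hmem : (a : ℂ) * u ∈ radialSet S ↔ u ∈ radialSet S := by
      simp only [radialSet, mem_ofPred_eq, hn]
    simp only [hf, rotation_apply]
    by_cases hu : u ∈ radialSet S
    · rw [indicator_of_mem hu, indicator_of_mem (hmem.2 hu), hn, map_mul, mul_pow, mul_pow]
      linear_combination ((starRingEnd ℂ) u ^ n * u ^ m *
        (Real.exp (-Real.pi * ‖u‖ ^ 2) : ℂ)) * hfac
    · rw [indicator_of_notMem hu, indicator_of_notMem (fun h => hu (hmem.1 h)), neg_zero]
  have h1 : ∫ u, f (rotation a u) = ∫ u, f u :=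
    ((rotation a).measurePreserving).integral_comp
      (rotation a).toHomeomorph.measurableEmbedding f
  simp only [hrot] at h1
  rw [integral_neg] at h1
  linear_combination -h1 / 2

/-! ### Completeness of the monomials -/

theorem integrableOn_polarCoord_symm {f : ℂ → ℂ} (hc : Continuous f) (hf : Integrable f) :
    IntegrableOn (fun p : ℝ × ℝ => p.1 • f (Complex.polarCoord.symm p)) polarCoord.target := by
  have hcs : Continuous fun p : ℝ × ℝ => Complex.polarCoord.symm p := by
    simp only [Complex.polarCoord_symm_apply]; fun_prop
  refine ⟨(continuous_fst.smul (hc.comp hcs)).aestronglyMeasurable.restrict, ?_⟩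
  have h := Complex.lintegral_comp_polarCoord_symm fun z => ‖f z‖ₑ
  have h2 : ∫⁻ p in polarCoord.target, ‖p.1 • f (Complex.polarCoord.symm p)‖ₑ =
      ∫⁻ p in polarCoord.target, ENNReal.ofReal p.1 • ‖f (Complex.polarCoord.symm p)‖ₑ := by
    refine setLIntegral_congr_fun polarCoord.open_target.measurableSet fun p hp => ?_
    have : (0 : ℝ) < p.1 := hp.1
    simp only [enorm_smul, smul_eq_mul]
    rw [Real.enorm_eq_ofReal this.le]
  rw [HasFiniteIntegral, h2, h]
  exact hf.2

/-- The `n`-th Taylor coefficient of an entire function at `0`, by Cauchy's formula. -/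
theorem integral_conj_circle_mul {G : ℂ → ℂ} (hG : Differentiable ℂ G) (n : ℕ) {r : ℝ}
    (hr : 0 < r) :
    ∫ θ in Ioo (-Real.pi) Real.pi, (starRingEnd ℂ) (circleMap 0 r θ) ^ n * G (circleMap 0 r θ) =
      (2 * Real.pi * r ^ (2 * n) : ℝ) * cauchyPowerSeries G 0 1 n fun _ => 1 := by
  have hpi := Real.pi_pos
  -- The Taylor coefficients do not depend on the radius; this is what allows them to be pulled out
  -- of the radial integral.
  have huniq : cauchyPowerSeries G 0 1 = cauchyPowerSeries G 0 r := by
    have h1 := (hG.hasFPowerSeriesOnBall 0 (R := 1) one_pos).hasFPowerSeriesAt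
    have h2 := (hG.hasFPowerSeriesOnBall 0 (R := ⟨r, hr.le⟩) hr).hasFPowerSeriesAt
    exact h1.eq_formalMultilinearSeries h2
  have hper : Function.Periodic
      (fun θ => (starRingEnd ℂ) (circleMap 0 r θ) ^ n * G (circleMap 0 r θ)) (2 * Real.pi) :=
    fun θ => by simp only [periodic_circleMap 0 r θ]
  rw [huniq, cauchyPowerSeries_apply, ← integral_Ioc_eq_integral_Ioo,
    ← intervalIntegral.integral_of_le (by linarith)]
  have h3 := hper.intervalIntegral_add_eq (-Real.pi) 0
  rw [show -Real.pi + 2 * Real.pi = Real.pi by ring, zero_add] at h3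
  rw [h3, circleIntegral, smul_eq_mul, ← mul_assoc, ← intervalIntegral.integral_const_mul]
  refine intervalIntegral.integral_congr fun θ _ => ?_
  have hz : circleMap 0 r θ ≠ 0 := by simp [circleMap, hr.ne']
  -- On the circle the conjugate is `r² / z`, which turns the integrand into the one of Cauchy's
  -- formula.
  have hzz : (starRingEnd ℂ) (circleMap 0 r θ) = r ^ 2 / circleMap 0 r θ := by
    rw [eq_div_iff hz, Complex.conj_mul', norm_circleMap_zero, abs_of_pos hr]
  simp only [deriv_circleMap, sub_zero, smul_eq_mul, hzz]
  have : (Real.pi : ℂ) ≠ 0 := by exact_mod_cast hpi.ne'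
  push_cast
  field_simp
  rw [div_pow, div_pow, one_pow, ← pow_mul]
  ring

/-- In polar coordinates the `n`-th integral is the `n`-th Taylor coefficient of `G` times a
positive Gamma integral, so all coefficients vanish. -/
theorem eq_zero_of_integral_conj_pow_mul_eq_zero {G : ℂ → ℂ} (hG : Differentiable ℂ G)
    (hint : ∀ n : ℕ, Integrable fun u : ℂ =>
      (starRingEnd ℂ) u ^ n * G u * (Real.exp (-Real.pi * ‖u‖ ^ 2) : ℂ))
    (hzero : ∀ n : ℕ, ∫ u : ℂ,
      (starRingEnd ℂ) u ^ n * G u * (Real.exp (-Real.pi * ‖u‖ ^ 2) : ℂ) = 0) : G = 0 := by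
  have hpi := Real.pi_pos
  have hcoef : ∀ n, (cauchyPowerSeries G 0 1 n fun _ => 1) = 0 := by
    intro n
    set a := cauchyPowerSeries G 0 1 n fun _ => 1 with ha
    have hcont : Continuous fun u : ℂ =>
        (starRingEnd ℂ) u ^ n * G u * (Real.exp (-Real.pi * ‖u‖ ^ 2) : ℂ) := by
      have := hG.continuous
      fun_prop
    have h1 := hzero n
    rw [← Complex.integral_comp_polarCoord_symm, polarCoord_target, Measure.volume_eq_prod,
      setIntegral_prod _ (by
        have := integrableOn_polarCoord_symm hcont (hint n)
        rwa [polarCoord_target, Measure.volume_eq_prod] at this)] at h1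
    have h2 : ∀ r ∈ Ioi (0 : ℝ), (∫ θ in Ioo (-Real.pi) Real.pi, r •
        ((starRingEnd ℂ) (Complex.polarCoord.symm (r, θ)) ^ n *
          G (Complex.polarCoord.symm (r, θ)) *
          (Real.exp (-Real.pi * ‖Complex.polarCoord.symm (r, θ)‖ ^ 2) : ℂ))) =
        ((r ^ (2 * n + 1 : ℝ) * Real.exp (-Real.pi * r ^ (2 : ℝ)) : ℝ) : ℂ) *
          (2 * Real.pi * a) := by
      intro r hr
      have hr' : (0 : ℝ) < r := hr
      have hc : ∀ θ, Complex.polarCoord.symm (r, θ) = circleMap 0 r θ := by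
        intro θ
        simp [circleMap, Complex.exp_mul_I]
      have e : (fun θ => r • ((starRingEnd ℂ) (Complex.polarCoord.symm (r, θ)) ^ n *
          G (Complex.polarCoord.symm (r, θ)) *
          (Real.exp (-Real.pi * ‖Complex.polarCoord.symm (r, θ)‖ ^ 2) : ℂ))) = fun θ =>
          ((r * Real.exp (-Real.pi * r ^ 2) : ℝ) : ℂ) *
          ((starRingEnd ℂ) (circleMap 0 r θ) ^ n * G (circleMap 0 r θ)) := by
        ext θ
        rw [hc, norm_circleMap_zero, abs_of_pos hr', Complex.real_smul]
        push_cast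
        ring
      rw [e, integral_const_mul, integral_conj_circle_mul hG n hr',
        show (2 * n + 1 : ℝ) = ((2 * n + 1 : ℕ) : ℝ) by push_cast; ring, Real.rpow_natCast,
        Real.rpow_two]
      push_cast
      ring
    rw [setIntegral_congr_fun measurableSet_Ioi h2, integral_mul_const, integral_complex_ofReal,
      integral_rpow_mul_exp_neg_mul_rpow two_pos (by linarith [(n.cast_nonneg : (0 : ℝ) ≤ n)])
        hpi] at h1
    rcases mul_eq_zero.1 h1 with h | h
    · rw [Complex.ofReal_eq_zero] at h
      have : 0 < Real.Gamma ((2 * n + 1 + 1 : ℝ) / 2) := Real.Gamma_pos_of_pos (by positivity)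
      exact absurd h (by positivity)
    · refine (mul_eq_zero.1 h).resolve_left ?_
      exact mul_ne_zero two_ne_zero (by exact_mod_cast hpi.ne')
  ext z
  have hs := (hG.hasFPowerSeriesOnBall 0 (R := 1) one_pos).hasSum
    (y := z) (by simp)
  rw [zero_add] at hs
  refine hs.unique ?_
  have : (fun n => cauchyPowerSeries G 0 ((1 : NNReal) : ℝ) n fun _ => z) = fun _ => 0 := by
    ext n
    have e : (fun _ : Fin n => z) = fun _ : Fin n => z • (1 : ℂ) := by simp
    rw [e, ContinuousMultilinearMap.map_smul_univ, NNReal.coe_one, hcoef, smul_zero]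
  rw [this]
  exact hasSum_zero

/-- A trace bound: the weights sum to at most one, so the masses over any finite set of indices sum
to at most `|S|`. -/
theorem finite_setOf_le_poissonMass {S : Set ℝ} (hS : MeasurableSet S) (hS0 : S ⊆ Ioi 0)
    (hfin : volume S ≠ ∞) {t : ℝ} (ht : 0 < t) : {n | t ≤ poissonMass S n}.Finite := by
  by_contra hinf
  obtain ⟨N, hN⟩ := exists_nat_gt ((volume S).toReal / t)
  obtain ⟨J, hJ, hcard⟩ := Set.Infinite.exists_subset_card_eq hinf N
  have h1 : (N : ℝ) * t ≤ ∑ j ∈ J, poissonMass S j := by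
    rw [← hcard, ← nsmul_eq_mul]
    exact Finset.card_nsmul_le_sum _ _ _ fun j hj => hJ hj
  have h2 : ∑ j ∈ J, poissonMass S j ≤ (volume S).toReal := by
    simp only [poissonMass]
    rw [← integral_finsetSum _ fun j _ => integrableOn_poissonWeight hS hS0 hfin j]
    calc ∫ s in S, ∑ j ∈ J, poissonWeight j s ≤ ∫ s in S, (1 : ℝ) :=
          setIntegral_mono_on
            (integrable_finsetSum _ fun j _ => integrableOn_poissonWeight hS hS0 hfin j)
            (integrableOn_const hfin) hS
            fun s hs => sum_poissonWeight_le_one J (le_of_lt (hS0 hs))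
      _ = _ := by simp [Measure.real]
  rw [div_lt_iff₀ ht] at hN
  linarith

/-! ### Integrals against the Gaussian measure -/

theorem gaussMeasure_absolutelyContinuous : gaussMeasure ≪ (volume : Measure ℂ) :=
  withDensity_absolutelyContinuous _ _

theorem integral_gaussMeasure (g : ℂ → ℂ) :
    ∫ z, g z ∂gaussMeasure = ∫ z, (Real.exp (-Real.pi * ‖z‖ ^ 2) : ℂ) * g z := by
  rw [gaussMeasure, integral_withDensity_eq_integral_toReal_smul (by fun_prop)
    (Eventually.of_forall fun _ => ENNReal.ofReal_lt_top)]
  refine integral_congr_ae (Eventually.of_forall fun z => ?_)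
  simp only [ENNReal.toReal_ofReal (Real.exp_pos _).le, Complex.real_smul]

theorem integrable_gaussMeasure_iff {g : ℂ → ℂ} :
    Integrable g gaussMeasure ↔
      Integrable fun z => (Real.exp (-Real.pi * ‖z‖ ^ 2) : ℂ) * g z := by
  rw [gaussMeasure, integrable_withDensity_iff_integrable_smul' (by fun_prop)
    (Eventually.of_forall fun _ => ENNReal.ofReal_lt_top)]
  refine integrable_congr (Eventually.of_forall fun z => ?_)
  simp only [ENNReal.toReal_ofReal (Real.exp_pos _).le, Complex.real_smul]

/-! ### Monomials translated to an arbitrary centre -/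

/-- The translate to the centre `w` of the monomial `z ^ n` in the Fock space, up to a factor. -/
noncomputable def shiftedMonomial (w : ℂ) (n : ℕ) (z : ℂ) : ℂ :=
  (z - w) ^ n * Complex.exp (Real.pi * (starRingEnd ℂ) w * z)

theorem differentiable_shiftedMonomial (w : ℂ) (n : ℕ) :
    Differentiable ℂ (shiftedMonomial w n) := by
  unfold shiftedMonomial; fun_prop

/-- Expanding `‖u + w‖²` shows that the exponential factor of `shiftedMonomial` recentres the
Gaussian. What is left over is holomorphic in `u` and joins `g`. -/
theorem exp_mul_conj_shiftedMonomial_mul (w : ℂ) (n : ℕ) (g : ℂ → ℂ) (u : ℂ) :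
    (Real.exp (-Real.pi * ‖u + w‖ ^ 2) : ℂ) *
      ((starRingEnd ℂ) (shiftedMonomial w n (u + w)) * g (u + w)) =
    (starRingEnd ℂ) u ^ n * (g (u + w) * Complex.exp (-Real.pi * (starRingEnd ℂ) w * u)) *
      (Real.exp (-Real.pi * ‖u‖ ^ 2) : ℂ) := by
  have h : (Real.exp (-Real.pi * ‖u + w‖ ^ 2) : ℂ) *
      Complex.exp (Real.pi * w * ((starRingEnd ℂ) u + (starRingEnd ℂ) w)) =
      Complex.exp (-Real.pi * (starRingEnd ℂ) w * u) * (Real.exp (-Real.pi * ‖u‖ ^ 2) : ℂ) := by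
    push_cast
    rw [← Complex.exp_add, ← Complex.exp_add, ← Complex.conj_mul', ← Complex.conj_mul', map_add]
    congr 1
    ring
  simp only [shiftedMonomial, map_mul, map_pow, ← Complex.exp_conj, add_sub_cancel_right,
    Complex.conj_ofReal, Complex.conj_conj, map_add]
  linear_combination (starRingEnd ℂ) u ^ n * g (u + w) * h

theorem integral_conj_shiftedMonomial_mul (w : ℂ) (n : ℕ) (g : ℂ → ℂ) :
    ∫ z, (starRingEnd ℂ) (shiftedMonomial w n z) * g z ∂gaussMeasure =
      ∫ u : ℂ, (starRingEnd ℂ) u ^ n *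
        (g (u + w) * Complex.exp (-Real.pi * (starRingEnd ℂ) w * u)) *
        (Real.exp (-Real.pi * ‖u‖ ^ 2) : ℂ) := by
  rw [integral_gaussMeasure, ← integral_add_right_eq_self _ w]
  simp only [exp_mul_conj_shiftedMonomial_mul]

theorem integrable_conj_shiftedMonomial_mul_iff {w : ℂ} {n : ℕ} {g : ℂ → ℂ} :
    Integrable (fun z => (starRingEnd ℂ) (shiftedMonomial w n z) * g z) gaussMeasure ↔
      Integrable fun u : ℂ => (starRingEnd ℂ) u ^ n *
        (g (u + w) * Complex.exp (-Real.pi * (starRingEnd ℂ) w * u)) *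
        (Real.exp (-Real.pi * ‖u‖ ^ 2) : ℂ) := by
  rw [integrable_gaussMeasure_iff]
  simp only [← exp_mul_conj_shiftedMonomial_mul]
  exact ⟨fun h => h.comp_add_right w, fun h => by simpa using h.comp_sub_right w⟩

theorem shiftedMonomial_mul_exp (w : ℂ) (n : ℕ) (u : ℂ) :
    shiftedMonomial w n (u + w) * Complex.exp (-Real.pi * (starRingEnd ℂ) w * u) =
      u ^ n * (Real.exp (Real.pi * ‖w‖ ^ 2) : ℂ) := by
  rw [shiftedMonomial, add_sub_cancel_right, mul_assoc, ← Complex.exp_add]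
  push_cast
  rw [← Complex.conj_mul']
  congr 2
  ring

theorem memLp_shiftedMonomial (w : ℂ) (n : ℕ) : MemLp (shiftedMonomial w n) 2 gaussMeasure := by
  rw [memLp_two_iff_integrable_sq_norm
    (differentiable_shiftedMonomial w n).continuous.aestronglyMeasurable]
  have h : Integrable (fun z => (starRingEnd ℂ) (shiftedMonomial w n z) * shiftedMonomial w n z)
      gaussMeasure := by
    rw [integrable_conj_shiftedMonomial_mul_iff]
    have h1 := ((integrable_norm_pow_mul_exp n).ofReal (𝕜 := ℂ)).const_mul
      (Real.exp (Real.pi * ‖w‖ ^ 2) : ℂ)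
    refine h1.congr (Eventually.of_forall fun u => ?_)
    have h2 := conj_pow_mul_pow_mul_exp n u
    rw [← norm_pow_mul_exp_eq_poissonWeight] at h2
    simp only [shiftedMonomial_mul_exp]
    linear_combination -(Real.exp (Real.pi * ‖w‖ ^ 2) : ℂ) * h2
  refine h.norm.congr (Eventually.of_forall fun z => ?_)
  simp [sq]

/-- `shiftedMonomial w n` as an element of the Fock space. -/
noncomputable def fockMonomial (w : ℂ) (n : ℕ) : fockSpace :=
  ⟨(memLp_shiftedMonomial w n).toLp, shiftedMonomial w n, differentiable_shiftedMonomial w n,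
    MemLp.coeFn_toLp _⟩

theorem inner_fockMonomial (w : ℂ) (n : ℕ) {f : L2Gauss} {g : ℂ → ℂ}
    (hfg : f =ᵐ[gaussMeasure] g) :
    inner ℂ (fockMonomial w n : L2Gauss) f =
      ∫ z, (starRingEnd ℂ) (shiftedMonomial w n z) * g z ∂gaussMeasure := by
  rw [L2.inner_def]
  refine integral_congr_ae ?_
  filter_upwards [hfg, (memLp_shiftedMonomial w n).coeFn_toLp] with z h1 h2
  rw [fockMonomial, h1, h2, RCLike.inner_apply, mul_comm]

theorem fockMonomial_ae_eq (w : ℂ) (n : ℕ) :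
    (fockMonomial w n : L2Gauss) =ᵐ[gaussMeasure] shiftedMonomial w n :=
  MemLp.coeFn_toLp (memLp_shiftedMonomial w n)

/-! ### Diagonalization of the Toeplitz operator -/

theorem mulIndicator_ae_eq {Ω : Set ℂ} (hΩ : NullMeasurableSet Ω volume) (f : L2Gauss) :
    mulIndicator hΩ f =ᵐ[gaussMeasure] Ω.indicator f :=
  (memLp_indicator hΩ f).coeFn_toLp

theorem inner_toeplitz {Ω : Set ℂ} (hΩ : NullMeasurableSet Ω volume) (f g : fockSpace) :
    inner ℂ f (toeplitz hΩ g) = inner ℂ (f : L2Gauss) (mulIndicator hΩ g) :=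
  Submodule.inner_orthogonalProjectionOnto_eq_of_mem_left f _

theorem toeplitz_isSymmetric {Ω : Set ℂ} (hΩ : NullMeasurableSet Ω volume) :
    (toeplitz hΩ).toLinearMap.IsSymmetric := by
  intro f g
  have h1 := inner_toeplitz hΩ f g
  have h2 := inner_toeplitz hΩ g f
  simp only [ContinuousLinearMap.coe_coe]
  rw [h1, ← inner_conj_symm, h2, inner_conj_symm, L2.inner_def, L2.inner_def]
  refine integral_congr_ae ?_
  filter_upwards [mulIndicator_ae_eq hΩ f, mulIndicator_ae_eq hΩ g] with z hf hg
  rw [hf, hg]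
  by_cases hz : z ∈ Ω
  · rw [indicator_of_mem hz, indicator_of_mem hz]
  · rw [indicator_of_notMem hz, indicator_of_notMem hz, inner_zero_left, inner_zero_right]

/-- Recentring at `w` multiplies the translate of `F` by a nowhere vanishing entire function, which
reduces the claim to ordinary monomials. -/
theorem eq_zero_of_inner_fockMonomial_eq_zero (w : ℂ) {f : fockSpace}
    (hf : ∀ n, inner ℂ (fockMonomial w n) f = 0) : f = 0 := by
  obtain ⟨F, hF, hfF⟩ := f.2
  have hint : ∀ n, Integrable (fun z => (starRingEnd ℂ) (shiftedMonomial w n z) * F z)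
      gaussMeasure := fun n => by
    refine (L2.integrable_inner (𝕜 := ℂ) (fockMonomial w n : L2Gauss) (f : L2Gauss)).congr ?_
    filter_upwards [hfF, fockMonomial_ae_eq w n] with z h1 h2
    rw [h1, h2, RCLike.inner_apply, mul_comm]
  have hG : (fun u => F (u + w) * Complex.exp (-Real.pi * (starRingEnd ℂ) w * u)) = 0 := by
    refine eq_zero_of_integral_conj_pow_mul_eq_zero
      (by fun_prop) (fun n => integrable_conj_shiftedMonomial_mul_iff.1 (hint n)) fun n => ?_
    rw [← integral_conj_shiftedMonomial_mul, ← inner_fockMonomial w n hfF]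
    exact hf n
  have hF0 : F = 0 := by
    ext z
    have := congrFun hG (z - w)
    simpa [Complex.exp_ne_zero] using this
  rw [hF0] at hfF
  exact Subtype.ext (Lp.ext (hfF.trans (Lp.coeFn_zero _ _ _).symm))

theorem integral_conj_shiftedMonomial_mul_indicator {S : Set ℝ} (hS : MeasurableSet S)
    (w : ℂ) (n m : ℕ) :
    ∫ z, (starRingEnd ℂ) (shiftedMonomial w n z) *
      {z | z - w ∈ radialSet S}.indicator (shiftedMonomial w m) z ∂gaussMeasure =
    (Real.exp (Real.pi * ‖w‖ ^ 2) : ℂ) * ∫ u in radialSet S,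
      (starRingEnd ℂ) u ^ n * u ^ m * (Real.exp (-Real.pi * ‖u‖ ^ 2) : ℂ) := by
  rw [integral_conj_shiftedMonomial_mul, ← integral_const_mul,
    ← integral_indicator (measurableSet_radialSet hS)]
  refine integral_congr_ae (Eventually.of_forall fun u => ?_)
  simp only
  by_cases hu : u ∈ radialSet S
  · have hu' : u + w ∈ {z | z - w ∈ radialSet S} := by simpa using hu
    rw [indicator_of_mem hu', indicator_of_mem hu, shiftedMonomial_mul_exp]
    ring
  · have hu' : u + w ∉ {z | z - w ∈ radialSet S} := by simpa using hu
    rw [indicator_of_notMem hu', indicator_of_notMem hu]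
    ring

theorem inner_fockMonomial_mulIndicator {Ω : Set ℂ} (hΩ : NullMeasurableSet Ω volume)
    {S : Set ℝ} (hS : MeasurableSet S) (hS0 : S ⊆ Ioi 0) {w : ℂ}
    (hae : Ω =ᵐ[volume] {z | z - w ∈ radialSet S}) (n m : ℕ) :
    inner ℂ (fockMonomial w n : L2Gauss) (mulIndicator hΩ (fockMonomial w m)) =
      if n = m then ((Real.exp (Real.pi * ‖w‖ ^ 2) * (n.factorial / Real.pi ^ n) *
        poissonMass S n : ℝ) : ℂ) else 0 := by
  have h : mulIndicator hΩ (fockMonomial w m) =ᵐ[gaussMeasure]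
      {z | z - w ∈ radialSet S}.indicator (shiftedMonomial w m) :=
    (mulIndicator_ae_eq hΩ _).trans (indicator_ae_eq_of_ae_eq_set
      (gaussMeasure_absolutelyContinuous.ae_eq hae) |>.trans
      ((fockMonomial_ae_eq w m).mono fun z hz => by
        by_cases h : z ∈ {z | z - w ∈ radialSet S}
        · rw [indicator_of_mem h, indicator_of_mem h, hz]
        · rw [indicator_of_notMem h, indicator_of_notMem h]))
  rw [inner_fockMonomial w n h, integral_conj_shiftedMonomial_mul_indicator hS]
  split_ifs with hnm
  · rw [← hnm, integral_radialSet_self hS hS0]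
    push_cast
    ring
  · rw [integral_radialSet_of_ne hS hnm, mul_zero]

/-- The case `Ω = ℂ` of the previous computation, where every Poisson mass is `1`. -/
theorem inner_fockMonomial_fockMonomial (w : ℂ) (n m : ℕ) :
    inner ℂ (fockMonomial w n) (fockMonomial w m) =
      if n = m then ((Real.exp (Real.pi * ‖w‖ ^ 2) * (n.factorial / Real.pi ^ n) : ℝ) : ℂ)
        else 0 := by
  have hae : (univ : Set ℂ) =ᵐ[volume] {z | z - w ∈ radialSet (Ioi 0)} := by
    symm
    rw [ae_eq_univ]
    refine measure_mono_null (t := {w}) (fun z hz => ?_) (by simp)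
    by_contra hne
    have : 0 < ‖z - w‖ := norm_pos_iff.2 (sub_ne_zero.2 hne)
    exact hz (show 0 < Real.pi * ‖z - w‖ ^ 2 by have := Real.pi_pos; positivity)
  have h := inner_fockMonomial_mulIndicator MeasurableSet.univ.nullMeasurableSet measurableSet_Ioi
    subset_rfl hae n m
  have h2 : mulIndicator MeasurableSet.univ.nullMeasurableSet (fockMonomial w m : L2Gauss) =
      fockMonomial w m := by
    refine Lp.ext ((mulIndicator_ae_eq _ _).trans ?_)
    rw [indicator_univ]
  rw [h2, poissonMass_Ioi, mul_one] at h
  exact h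

theorem eigenvalue_eq_nthLargest {Ω : Set ℂ} (hΩ : NullMeasurableSet Ω volume)
    {S : Set ℝ} (hS : MeasurableSet S) (hS0 : S ⊆ Ioi 0) (hfin : volume S ≠ ∞) {w : ℂ}
    (hae : Ω =ᵐ[volume] {z | z - w ∈ radialSet S}) (k : ℕ) :
    eigenvalue hΩ k = nthLargest (poissonMass S) k := by
  have hpi := Real.pi_pos
  refine nthEigenvalue_eq_nthLargest (toeplitz_isSymmetric hΩ) (e := fockMonomial w) ?_ ?_
    (fun f => eq_zero_of_inner_fockMonomial_eq_zero w) ?_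
    (fun t ht => finite_setOf_le_poissonMass hS hS0 hfin ht) k
  · intro n hn
    have h := inner_fockMonomial_fockMonomial w n n
    rw [hn, inner_zero_left, if_pos rfl, eq_comm, Complex.ofReal_eq_zero] at h
    exact absurd h (by positivity)
  · intro n m hnm
    simp only [inner_fockMonomial_fockMonomial, if_neg hnm]
  · intro n
    -- The eigenvalue equation is tested against the complete family of monomials.
    rw [← sub_eq_zero]
    refine eq_zero_of_inner_fockMonomial_eq_zero w fun m => ?_
    rw [inner_sub_right, inner_smul_right, inner_fockMonomial_fockMonomial,
      ContinuousLinearMap.coe_coe, inner_toeplitz,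
      inner_fockMonomial_mulIndicator hΩ hS hS0 hae]
    split_ifs with h
    · rw [h]; push_cast; ring
    · ring

/-! ### Reduction to sets of areas and comparison with the disc -/

/-- A circularly symmetric set is, up to a null set, described by a measurable set of areas. -/
theorem IsCircularlySymmetric.exists_radialSet {Ω : Set ℂ} (h : IsCircularlySymmetric Ω) :
    ∃ (w : ℂ) (S : Set ℝ), MeasurableSet S ∧ S ⊆ Ioi 0 ∧
      Ω =ᵐ[volume] {z | z - w ∈ radialSet S} := by
  obtain ⟨w, E, hE0, hE, rfl⟩ := h
  have hpi := Real.pi_pos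
  -- `E` is only Lebesgue measurable, so it is replaced by a Borel set; the radii where the two
  -- differ form a null set, which must be shown to give a null set in the plane.
  obtain ⟨E', -, hE'm, hE'⟩ := hE.exists_measurable_superset_ae_eq
  set S : Set ℝ := Ioi 0 ∩ (fun s => √(s / Real.pi)) ⁻¹' E' with hSdef
  have hSm : MeasurableSet S := measurableSet_Ioi.inter
    ((by fun_prop : Measurable fun s : ℝ => √(s / Real.pi)) hE'm)
  refine ⟨w, S, hSm, inter_subset_left, ?_⟩
  have hN : volume {r : ℝ | ¬ (r ∈ E ↔ r ∈ E')} = 0 := by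
    have := hE'.mem_iff
    rw [ae_iff] at this
    refine measure_mono_null (fun r hr => ?_) this
    simp only [mem_ofPred_eq] at hr ⊢
    tauto
  set N := {r : ℝ | ¬ (r ∈ E ↔ r ∈ E')} with hNdef
  -- A differentiable map sends null sets to null sets; `map_pi_mul_norm_sq` then carries this back
  -- to the plane.
  have hN2 : volume ((fun r : ℝ => Real.pi * r ^ 2) '' N) = 0 :=
    addHaar_image_eq_zero_of_differentiableOn_of_addHaar_eq_zero volume (by fun_prop) hN
  have hN3 : ∀ᵐ u : ℂ, Real.pi * ‖u‖ ^ 2 ∉ (fun r : ℝ => Real.pi * r ^ 2) '' N := by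
    have h1 : ∀ᵐ t ∂(Measure.map (fun z : ℂ => Real.pi * ‖z‖ ^ 2) volume),
        t ∉ (fun r : ℝ => Real.pi * r ^ 2) '' N := by
      rw [map_pi_mul_norm_sq]
      exact ae_restrict_of_ae (measure_eq_zero_iff_ae_notMem.1 hN2)
    exact ae_of_ae_map (f := fun z : ℂ => Real.pi * ‖z‖ ^ 2) (by fun_prop) h1
  have hN4 : ∀ᵐ z : ℂ, Real.pi * ‖z - w‖ ^ 2 ∉ (fun r : ℝ => Real.pi * r ^ 2) '' N :=
    (measurePreserving_sub_right volume w).quasiMeasurePreserving.ae hN3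
  have hne : ∀ᵐ z : ℂ, z ≠ w := measure_eq_zero_iff_ae_notMem.1 (measure_singleton w)
  filter_upwards [hN4, hne] with z hz hzw
  have hpos : 0 < ‖z - w‖ := norm_pos_iff.2 (sub_ne_zero.2 hzw)
  have hiff : ‖z - w‖ ∈ E ↔ ‖z - w‖ ∈ E' := by
    by_contra hcon
    exact hz ⟨_, hcon, rfl⟩
  have hsq : √(Real.pi * ‖z - w‖ ^ 2 / Real.pi) = ‖z - w‖ := by
    rw [mul_div_cancel_left₀ _ hpi.ne', Real.sqrt_sq hpos.le]
  refine propext (hiff.trans ?_)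
  change _ ↔ 0 < Real.pi * ‖z - w‖ ^ 2 ∧ √(Real.pi * ‖z - w‖ ^ 2 / Real.pi) ∈ E'
  rw [hsq]
  exact ⟨fun h => ⟨by positivity, h⟩, fun h => h.2⟩

theorem volume_setOf_sub_mem_radialSet {S : Set ℝ} (hS : MeasurableSet S) (hS0 : S ⊆ Ioi 0)
    (w : ℂ) : volume {z | z - w ∈ radialSet S} = volume S := by
  rw [← volume_radialSet hS hS0]
  exact (measurePreserving_sub_right volume w).measure_preimage
    (measurableSet_radialSet hS).nullMeasurableSet

theorem ball_ae_eq_radialSet (c : ℂ) {r : ℝ} (hr : 0 < r) :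
    Metric.ball c r =ᵐ[volume] {z | z - c ∈ radialSet (Ioo 0 (Real.pi * r ^ 2))} := by
  have hpi := Real.pi_pos
  have hne : ∀ᵐ z : ℂ, z ≠ c := measure_eq_zero_iff_ae_notMem.1 (measure_singleton c)
  filter_upwards [hne] with z hz
  have hpos : 0 < ‖z - c‖ := norm_pos_iff.2 (sub_ne_zero.2 hz)
  refine propext ?_
  change dist z c < r ↔ 0 < Real.pi * ‖z - c‖ ^ 2 ∧ Real.pi * ‖z - c‖ ^ 2 < Real.pi * r ^ 2
  rw [dist_eq_norm, mul_lt_mul_iff_right₀ hpi, sq_lt_sq₀ hpos.le hr.le]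
  exact ⟨fun h => ⟨by positivity, h⟩, fun h => h.2⟩

/-- Greedy choice of indices combined with the rearrangement inequality; the error `m * ε` tends to
zero. -/
theorem sum_nthLargest_poissonMass_le {S : Set ℝ} (hS : MeasurableSet S) (hS0 : S ⊆ Ioi 0)
    (hpos : volume S ≠ 0) (hfin : volume S ≠ ∞) (m : ℕ) :
    ∑ k ∈ Finset.range m, nthLargest (poissonMass S) (k + 1) ≤
      poissonCdfPrimitive m (volume S).toReal := by
  have hlim : Tendsto (fun ε : ℝ => poissonCdfPrimitive m (volume S).toReal + m * ε) (𝓝[>] 0)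
      (𝓝 (poissonCdfPrimitive m (volume S).toReal)) := by
    have hcont : Continuous fun ε : ℝ =>
      poissonCdfPrimitive m (volume S).toReal + m * ε := by fun_prop
    simpa using (hcont.tendsto 0).mono_left (nhdsWithin_le_nhds (s := Ioi 0))
  refine ge_of_tendsto hlim (eventually_nhdsWithin_of_forall fun ε hε => ?_)
  obtain ⟨J, hJ, hle⟩ := exists_card_sum_nthLargest_le
    (fun t ht => finite_setOf_le_poissonMass hS hS0 hfin ht)
    (poissonMass_pos hS hS0 hpos hfin) m hε
  have := sum_poissonMass_le hS hS0 hfin J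
  rw [hJ] at this
  linarith

/-- The rearrangement inequality for one index: it bounds every eigenvalue by the top one of the
disc, which is below `1`. -/
theorem poissonMass_le_poissonMass_Ioo_zero {S : Set ℝ} (hS : MeasurableSet S)
    (hS0 : S ⊆ Ioi 0) (hfin : volume S ≠ ∞) (n : ℕ) :
    poissonMass S n ≤ poissonMass (Ioo 0 (volume S).toReal) 0 := by
  have h := sum_poissonMass_le hS hS0 hfin {n}
  rw [Finset.card_singleton, ← sum_poissonMass_Ioo ENNReal.toReal_nonneg] at h
  simpa using h

end FockToeplitz

open FockToeplitz in
theorem corollary3p3 (Ω : Set ℂ) (hΩ : NullMeasurableSet Ω volume)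
    (hsymm : FockToeplitz.IsCircularlySymmetric Ω)
    (hpos : volume Ω ≠ 0) (hfin : volume Ω ≠ ∞)
    (Ωstar : Set ℂ) (hΩstar : NullMeasurableSet Ωstar volume)
    (hball : ∃ (c : ℂ) (r : ℝ), Ωstar = Metric.ball c r) (hvol : volume Ωstar = volume Ω) :
    (∀ k : ℕ, 1 ≤ k →
      FockToeplitz.eigenvalue hΩ k ∈ Ioo (0 : ℝ) 1 ∧
      FockToeplitz.eigenvalue hΩstar k ∈ Ioo (0 : ℝ) 1) ∧
    ∀ (n : ℕ), 1 ≤ n → ∀ (Φ : ℝ → ℝ), ConvexOn ℝ (Ioo 0 1) Φ → MonotoneOn Φ (Ioo 0 1) →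
      ∑ k ∈ Finset.Icc 1 n, Φ (FockToeplitz.eigenvalue hΩ k) ≤
      ∑ k ∈ Finset.Icc 1 n, Φ (FockToeplitz.eigenvalue hΩstar k) := by
  have hpi := Real.pi_pos
  obtain ⟨w, S, hS, hS0, hae⟩ := hsymm.exists_radialSet
  have hvolS : volume S = volume Ω := by
    rw [measure_congr hae, volume_setOf_sub_mem_radialSet hS hS0]
  obtain ⟨c, r, rfl⟩ := hball
  have hr : 0 < r := by
    by_contra! hr
    rw [Metric.ball_eq_empty.2 hr, measure_empty] at hvol
    exact hpos hvol.symm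
  set L := Real.pi * r ^ 2 with hL
  have hL0 : 0 < L := by positivity
  have hball := ball_ae_eq_radialSet c hr
  have hIoo : Ioo 0 L ⊆ Ioi 0 := fun _ h => h.1
  have hvolIoo : volume (Ioo 0 L) = volume Ω := by
    rw [← hvol, measure_congr hball, volume_setOf_sub_mem_radialSet measurableSet_Ioo hIoo]
  have hLS : (volume S).toReal = L := by
    rw [hvolS, ← hvolIoo, Real.volume_Ioo, sub_zero, ENNReal.toReal_ofReal hL0.le]
  rw [← hvolS] at hpos hfin
  have hfinS := fun t ht => finite_setOf_le_poissonMass (t := t) hS hS0 hfin ht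
  have hposS := poissonMass_pos hS hS0 hpos hfin
  have hbd : ∀ n, poissonMass S n ≤ poissonMass (Ioo 0 L) 0 := by
    have := poissonMass_le_poissonMass_Ioo_zero hS hS0 hfin
    rwa [hLS] at this
  have hpos' : volume (Ioo 0 L) ≠ 0 := by rw [hvolIoo, ← hvolS]; exact hpos
  have hfin' : volume (Ioo 0 L) ≠ ∞ := by rw [hvolIoo, ← hvolS]; exact hfin
  have heig : ∀ k, eigenvalue hΩ k = nthLargest (poissonMass S) k :=
    eigenvalue_eq_nthLargest hΩ hS hS0 hfin hae
  have heigstar : ∀ k, eigenvalue hΩstar (k + 1) = poissonMass (Ioo 0 L) k := fun k => by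
    rw [eigenvalue_eq_nthLargest hΩstar measurableSet_Ioo hIoo hfin' hball,
      nthLargest_eq_of_antitone
        (fun t ht => finite_setOf_le_poissonMass measurableSet_Ioo hIoo hfin' ht)
        (poissonMass_pos measurableSet_Ioo hIoo hpos' hfin') (antitone_poissonMass_Ioo hL0.le)]
  have hmem : ∀ k, eigenvalue hΩ (k + 1) ∈ Ioo (0 : ℝ) 1 := fun k => by
    rw [heig]
    exact ⟨nthLargest_pos hfinS hbd hposS (Nat.le_add_left 1 k),
      (nthLargest_le hfinS hbd hposS (Nat.le_add_left 1 k)).trans_lt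
        (poissonMass_Ioo_lt_one hL0.le 0)⟩
  have hmemstar : ∀ k, eigenvalue hΩstar (k + 1) ∈ Ioo (0 : ℝ) 1 := fun k => by
    rw [heigstar]
    exact ⟨poissonMass_pos measurableSet_Ioo hIoo hpos' hfin' k,
      poissonMass_Ioo_lt_one hL0.le k⟩
  refine ⟨fun k hk => ?_, fun n _ Φ hconv hmono => ?_⟩
  · obtain ⟨k, rfl⟩ := Nat.exists_eq_add_of_le' hk
    exact ⟨hmem k, hmemstar k⟩
  -- Eigenvalues are numbered from `1`, monomial degrees from `0`.
  · have hsum : ∀ f : ℕ → ℝ, ∑ k ∈ Finset.Icc 1 n, f k = ∑ k ∈ Finset.range n, f (k + 1) := by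
      intro f
      rw [Finset.range_eq_Ico, Finset.sum_Ico_add' f 0 n 1, zero_add]
      rfl
    rw [hsum, hsum]
    refine sum_le_sum_of_weakly_majorized isOpen_Ioo hconv hmono hmem hmemstar ?_ ?_ n
    · intro k l hkl
      simp only [heig]
      exact nthLargest_anti hfinS hbd hposS (Nat.le_add_left 1 k) (Nat.succ_le_succ hkl)
    · intro m
      simp only [heig, heigstar]
      rw [sum_poissonMass_Ioo hL0.le, ← hLS]
      exact sum_nthLargest_poissonMass_le hS hS0 hpos hfin m
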